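/- Fix $r\in(0,\infty)$. For $n\ge 1$ and $\theta\in\mathbb{R}^n$ let $X\sim N_n(\theta,I)$ and $Y\sim N_n(\theta,rI)$ be independent, with densities $p(x\mid\theta,1)$ and $p(y\mid\theta,r)$. A predictive density estimate $\hat p(y\mid x)$ is a jointly measurable function that is a probability density in $y$ for every $x$; its Kullback–Leibler risk is $$\rho(\theta,\hat p)=\int\!\!\int p(y\mid\theta,r)\log\frac{p(y\mid\theta,r)}{\hat p(y\mid x)}\,dy\;p(x\mid\theta,1)\,dx\in[0,\infty],$$ and the minimax risk over $\Theta\subseteq\mathbb{R}^n$ is $R_N(\Theta)=\inf_{\hat p}\sup_{\theta\in\Theta}\rho(\theta,\hat p)$, the infimum being over all predictive density estimates. For $s,t>0$ let $\Theta_n[s,t]=\{\theta\in\mathbb{R}^n:\#\{i:\theta_i\ne0\}\le s,\ |\theta_i|\le t\text{ for all }i\}$. For $\eta\in[0,1]$ and $l>0$ let $\pi_S[\eta,l]=(1-\eta)\delta_0+\frac{\eta}{2l}\mathbf 1\{\mu\in[-l,l]\}\,d\mu$. Let $s_n\ge1$ and $t_n$ be real sequences and put $\eta_n=s_n/n$.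 Suppose that, as $n\to\infty$, $\eta_n\to0$, $t_n/(\log\eta_n^{-1})^{1/2}\to\infty$ and $\log t_n/\log\eta_n^{-1}\to0$. Let $\hat p_S[t_n](y\mid x)=\int p(y\mid\theta,r)\,\pi_n(d\theta\mid x)$ be the Bayes predictive density for the prior $\pi_n$ on $\mathbb{R}^n$ under which the $n$ coordinates are i.i.d. from $\pi_S[\eta_n,t_n]$ (defined for all large $n$), where $\pi_n(d\theta\mid x)$ is the posterior given $X=x$. Then $$\lim_{n\to\infty}\ \frac{\sup_{\theta\in\Theta_n[s_n,t_n]}\rho(\theta,\hat p_S[t_n])}{R_N(\Theta_n[s_n,t_n])}=1 .$$ -/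

import Mathlib

open MeasureTheory ProbabilityTheory Filter Topology
open scoped ENNReal NNReal

noncomputable section

namespace SparsePrediction

/-- The density `p(x | θ, v)` of the Gaussian law `N_n(θ, v I)` on `ℝⁿ`. -/
def gaussianDensity {n : ℕ} (v : ℝ≥0) (θ x : Fin n → ℝ) : ℝ≥0∞ :=
  ∏ i, gaussianPDF (θ i) v (x i)

/-- The Gaussian law `N_n(θ, v I)`, as the measure with density `p(· | θ, v)`. -/
def gaussianLaw {n : ℕ} (v : ℝ≥0) (θ : Fin n → ℝ) : Measure (Fin n → ℝ) :=
  volume.withDensity (gaussianDensity v θ)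

/-- A predictive density estimate `p̂(y | x)`, written `q x y`: jointly measurable in `(x, y)`, and
a probability density in `y` for every observation `x`. -/
structure IsPDE {n : ℕ} (q : (Fin n → ℝ) → (Fin n → ℝ) → ℝ≥0∞) : Prop where
  measurable : Measurable (Function.uncurry q)
  lintegral_eq_one : ∀ x, ∫⁻ y, q x y = 1

/-- The Kullback-Leibler loss `∫ p(y | θ, r) log (p(y | θ, r) / q(y)) dy` of a density `q` for the
future observation `Y ∼ N_n(θ, r I)`; it may be infinite. -/
def klLoss {n : ℕ} (r : ℝ≥0) (θ : Fin n → ℝ) (q : (Fin n → ℝ) → ℝ≥0∞) : ℝ≥0∞ :=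
  InformationTheory.klDiv (gaussianLaw r θ) (volume.withDensity q)

/-- The predictive risk `ρ(θ, p̂)`: the loss averaged over the past observation
`X ∼ N_n(θ, I)`. -/
def risk {n : ℕ} (r : ℝ≥0) (θ : Fin n → ℝ) (q : (Fin n → ℝ) → (Fin n → ℝ) → ℝ≥0∞) : ℝ≥0∞ :=
  ∫⁻ x, klLoss r θ (q x) ∂(gaussianLaw 1 θ)

/-- The maximum risk of a predictive density estimate over a parameter set. -/
def maxRisk {n : ℕ} (r : ℝ≥0) (Θ : Set (Fin n → ℝ))
    (q : (Fin n → ℝ) → (Fin n → ℝ) → ℝ≥0∞) : ℝ≥0∞ :=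
  ⨆ θ ∈ Θ, risk r θ q

/-- The minimax risk `R_N(Θ)`, the infimum being over all predictive density estimates. -/
def minimaxRisk {n : ℕ} (r : ℝ≥0) (Θ : Set (Fin n → ℝ)) : ℝ≥0∞ :=
  ⨅ (q : (Fin n → ℝ) → (Fin n → ℝ) → ℝ≥0∞) (_ : IsPDE q), maxRisk r Θ q

/-- The posterior `π(dθ | x)` after observing `X = x`, where `X ∼ N_n(θ, I)` given `θ`
(Bayes' formula). -/
def posteriorLaw {n : ℕ} (π : Measure (Fin n → ℝ)) (x : Fin n → ℝ) : Measure (Fin n → ℝ) :=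
  (∫⁻ θ, gaussianDensity 1 θ x ∂π)⁻¹ • π.withDensity (fun θ => gaussianDensity 1 θ x)

/-- The Bayes predictive density `p̂_π(y | x) = ∫ p(y | θ, r) π(dθ | x)`. -/
def bayesPDE {n : ℕ} (r : ℝ≥0) (π : Measure (Fin n → ℝ)) (x y : Fin n → ℝ) : ℝ≥0∞ :=
  ∫⁻ θ, gaussianDensity r θ y ∂(posteriorLaw π x)

/-- The spike and uniform slab prior `(1 - η) δ₀ + η / (2 l) 1{μ ∈ [-l, l]} dμ` on `ℝ`. -/
def spikeSlab (η l : ℝ) : Measure ℝ :=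
  ENNReal.ofReal (1 - η) • Measure.dirac 0 +
    ENNReal.ofReal (η / (2 * l)) • volume.restrict (Set.Icc (-l) l)

/-- The Bayes predictive density `p̂_S[l]` on `ℝⁿ` for the prior with `n` i.i.d. spike and slab
coordinates of sparsity `η`. -/
def spikeSlabPDE (n : ℕ) (r : ℝ≥0) (η l : ℝ) : (Fin n → ℝ) → (Fin n → ℝ) → ℝ≥0∞ :=
  bayesPDE r (Measure.pi fun _ : Fin n => spikeSlab η l)

/-- The bounded sparse set `Θ_n[s, t]`: at most `s` nonzero coordinates, all in `[-t, t]`. -/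
def sparseSet (n : ℕ) (s t : ℝ) : Set (Fin n → ℝ) :=
  {θ | (hammingNorm θ : ℝ) ≤ s ∧ ∀ i, |θ i| ≤ t}

end SparsePrediction

end

/-! Put `Λ = log η⁻¹` and `k = ⌊s⌋`. Both the minimax risk and the maximum risk of the spike and
slab rule equal `k Λ / (1 + r)` to leading order, so their ratio is squeezed to 1.

Lower bound (`ofReal_le_minimaxRisk`). Cut the coordinates into `k` blocks of `m ≈ n / k` and hide
one spike of height `a` in each, where `a² / 2 + a² / (2r) = log m`: the past observation alone
cannot locate the spike, while past and future together are just at the edge of doing so. Apply the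
Donsker-Varadhan inequality with test function `k (log m - a² / 2)` minus a penalty. Averaged over
the spike positions, its exponential moment is at most 1, because in each block the integrand is
bounded by `m` times the posterior weight of the position given both observations, and these weights
sum to 1 (`likRatio_mul_exp_sub_blockPenalty_le`). The mean penalty is `O(k (a + 1))`, of lower
order, and `log m - a² / 2 = log m / (1 + r)`.

Upper bound (`maxRisk_spikeSlabPDE_le`). For a product prior the predictive density is a product of
ratios of joint to single marginals. The log likelihood ratio is dominated by a function affine in
`y`, so the risk splits into univariate means. A zero coordinate costs at most `2η`, hence `O(k)` in
total (`exists_dominates_zero`). A nonzero one costs at most `Λ / (1 + r) + O(√Λ) + log (2t) + O(1)`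
(`exists_dominates`): the joint marginal is bounded below by the spike when `θ` is small and by the
slab near `θ` otherwise, and the two costs balance at `Λ / (1 + r)`. The growth conditions on `t`
make spikes of height `a` admissible and `log t` negligible. -/

namespace SparsePrediction

/-! ### Product densities and Gaussian laws on `ℝⁿ`. -/

theorem lintegral_pi_prod {n : ℕ} (μ : Fin n → Measure ℝ) [∀ i, SigmaFinite (μ i)]
    (f : Fin n → ℝ → ℝ≥0∞) (hf : ∀ i, Measurable (f i)) :
    ∫⁻ x, ∏ i, f i (x i) ∂(Measure.pi μ) = ∏ i, ∫⁻ x, f i x ∂(μ i) := by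
  induction n with
  | zero => simp
  | succ n ih =>
    rw [Fin.prod_univ_succ, ← ih _ _ (fun i => hf i.succ),
      ← lintegral_prod_mul (hf 0).aemeasurable
        (Finset.measurable_prod _ fun i _ => (hf i.succ).comp (measurable_pi_apply i)).aemeasurable,
      ← ((measurePreserving_piFinSuccAbove μ 0).symm).lintegral_comp_emb
        (MeasurableEquiv.measurableEmbedding _)]
    simp_rw [Fin.prod_univ_succ]
    rfl

theorem pi_withDensity {n : ℕ} (f : Fin n → ℝ → ℝ≥0∞) (hf : ∀ i, Measurable (f i))
    (h : ∀ i, ∫⁻ x, f i x ≠ ∞) :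
    Measure.pi (fun i => (volume : Measure ℝ).withDensity (f i)) =
      (volume : Measure (Fin n → ℝ)).withDensity (fun x => ∏ i, f i (x i)) := by
  have hfin : ∀ i, IsFiniteMeasure ((volume : Measure ℝ).withDensity (f i)) := fun i =>
    isFiniteMeasure_withDensity (h i)
  refine Measure.pi_eq fun s hs => ?_
  rw [withDensity_apply _ (MeasurableSet.univ_pi hs), ← lintegral_indicator (MeasurableSet.univ_pi hs)]
  have : (Set.univ.pi s).indicator (fun x => ∏ i, f i (x i)) =
      fun x => ∏ i, (s i).indicator (f i) (x i) := by
    ext x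
    by_cases hx : x ∈ Set.univ.pi s
    · rw [Set.indicator_of_mem hx]
      exact Finset.prod_congr rfl fun i _ => (Set.indicator_of_mem (hx i trivial) _).symm
    · rw [Set.indicator_of_notMem hx]
      simp only [Set.mem_pi, Set.mem_univ, true_imp_iff, not_forall] at hx
      obtain ⟨i, hi⟩ := hx
      exact (Finset.prod_eq_zero (Finset.mem_univ i) (Set.indicator_of_notMem hi _)).symm
  rw [this, volume_pi, lintegral_pi_prod _ _ fun i => (hf i).indicator (hs i)]
  exact Finset.prod_congr rfl fun i _ => by
    rw [lintegral_indicator (hs i), withDensity_apply _ (hs i)]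

theorem gaussianLaw_eq_pi {n : ℕ} {v : ℝ≥0} (hv : v ≠ 0) (θ : Fin n → ℝ) :
    gaussianLaw v θ = Measure.pi fun i => gaussianReal (θ i) v := by
  simp_rw [gaussianReal_of_var_ne_zero _ hv]
  rw [pi_withDensity _ (fun i => measurable_gaussianPDF _ _)
    fun i => by rw [lintegral_gaussianPDF_eq_one _ hv]; simp]
  rfl

theorem isProbabilityMeasure_gaussianLaw {n : ℕ} {v : ℝ≥0} (hv : v ≠ 0) (θ : Fin n → ℝ) :
    IsProbabilityMeasure (gaussianLaw v θ) := by
  rw [gaussianLaw_eq_pi hv]; infer_instance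

theorem measurable_gaussianDensity {n : ℕ} (v : ℝ≥0) (θ : Fin n → ℝ) :
    Measurable (gaussianDensity v θ) :=
  Finset.measurable_fun_prod _ fun i _ =>
    (measurable_gaussianPDF (θ i) v).comp (measurable_pi_apply i)

theorem lintegral_gaussianDensity {n : ℕ} {v : ℝ≥0} (hv : v ≠ 0) (θ : Fin n → ℝ) :
    ∫⁻ y, gaussianDensity v θ y = 1 := by
  have := (isProbabilityMeasure_gaussianLaw hv θ).measure_univ
  rwa [gaussianLaw, withDensity_apply _ MeasurableSet.univ, Measure.restrict_univ] at this

/-! ### Two-sided control of the Kullback-Leibler divergence -/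

section KL

open InformationTheory

variable {α : Type*} {mα : MeasurableSpace α} {μ ν : Measure α}

/-- `klFun F` is at most `F U + (1 - F)`, and `1 - F` has `ν`-mean zero. The sign of the mean of `U`
is recorded because the risk integrates its `ENNReal.ofReal` over `x`, which is linear only when
nothing is truncated. -/
theorem klDiv_le_of_density_le_exp [IsProbabilityMeasure μ] [IsProbabilityMeasure ν]
    {F : α → ℝ≥0∞} (hF : Measurable F) (hμ : μ = ν.withDensity F) {U : α → ℝ}
    (hFU : ∀ y, F y ≤ ENNReal.ofReal (Real.exp (U y))) (hU : Integrable U μ) :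
    klDiv μ ν ≤ ENNReal.ofReal (∫ y, U y ∂μ) ∧ 0 ≤ ∫ y, U y ∂μ := by
  have hFtop : ∀ y, F y < ∞ := fun y => (hFU y).trans_lt ENNReal.ofReal_lt_top
  have hac : μ ≪ ν := hμ ▸ withDensity_absolutelyContinuous _ _
  have hpt : ∀ y, klFun (F y).toReal ≤ (F y).toReal * U y + (1 - (F y).toReal) := by
    intro y
    rw [klFun_apply]
    rcases eq_or_lt_of_le (ENNReal.toReal_nonneg (a := F y)) with h0 | h0
    · simp [← h0]
    · have h1 : (F y).toReal ≤ Real.exp (U y) :=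
        ENNReal.toReal_le_of_le_ofReal (Real.exp_pos _).le (hFU y)
      have h2 : Real.log (F y).toReal ≤ U y := (Real.log_le_iff_le_exp h0).2 h1
      nlinarith
  have hFi : Integrable (fun y => (F y).toReal) ν := by
    refine integrable_toReal_of_lintegral_ne_top hF.aemeasurable ?_
    rw [← setLIntegral_univ, ← withDensity_apply _ MeasurableSet.univ, ← hμ]
    exact measure_ne_top _ _
  have hF1 : ∫ y, (F y).toReal ∂ν = 1 := by
    rw [integral_toReal hF.aemeasurable (ae_of_all _ hFtop), ← setLIntegral_univ,
      ← withDensity_apply _ MeasurableSet.univ, ← hμ]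
    simp
  have hUi : Integrable (fun y => (F y).toReal * U y) ν := by
    rw [hμ, integrable_withDensity_iff_integrable_smul' hF (ae_of_all _ hFtop)] at hU
    exact hU
  have hUe : ∫ y, U y ∂μ = ∫ y, (F y).toReal * U y ∂ν := by
    rw [hμ, integral_withDensity_eq_integral_toReal_smul hF (ae_of_all _ hFtop)]
    rfl
  have hint : Integrable (fun y => (F y).toReal * U y + (1 - (F y).toReal)) ν :=
    hUi.add ((integrable_const _).sub hFi)
  have hval : ∫ y, ((F y).toReal * U y + (1 - (F y).toReal)) ∂ν = ∫ y, U y ∂μ := by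
    have h1 : Integrable (fun y => 1 - (F y).toReal) ν := (integrable_const _).sub hFi
    rw [integral_add hUi h1, integral_sub (integrable_const _) hFi, hF1, hUe]
    simp
  have hnn : ∀ y, 0 ≤ (F y).toReal * U y + (1 - (F y).toReal) := fun y =>
    (klFun_nonneg ENNReal.toReal_nonneg).trans (hpt y)
  refine ⟨?_, hval ▸ integral_nonneg hnn⟩
  rw [klDiv_eq_lintegral_klFun_of_ac hac, ← hval,
    ofReal_integral_eq_lintegral_ofReal hint (ae_of_all _ hnn)]
  refine lintegral_mono_ae ?_
  have := Measure.rnDeriv_withDensity ν hF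
  rw [← hμ] at this
  filter_upwards [this] with y hy
  rw [hy]
  exact ENNReal.ofReal_le_ofReal (hpt y)

theorem ofReal_integral_le_lintegral {f : α → ℝ} (hf : Integrable f μ) :
    ENNReal.ofReal (∫ y, f y ∂μ) ≤ ∫⁻ y, ENNReal.ofReal (f y) ∂μ := by
  rw [integral_eq_lintegral_pos_part_sub_lintegral_neg_part hf]
  refine (ENNReal.ofReal_le_ofReal (sub_le_self _ ENNReal.toReal_nonneg)).trans ?_
  exact ENNReal.ofReal_toReal_le

/-- The Fenchel-Young inequality for the conjugate pair `klFun` and `exp - 1`. -/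
theorem mul_le_klFun_add_exp {f : ℝ} (hf : 0 ≤ f) (g : ℝ) :
    g * f + 1 ≤ klFun f + Real.exp g := by
  rw [klFun_apply]
  rcases eq_or_lt_of_le hf with h0 | h0
  · simp [← h0, (Real.exp_pos g).le]
  · have h1 := Real.add_one_le_exp (g - Real.log f)
    rw [Real.exp_sub, Real.exp_log h0, le_div_iff₀ h0] at h1
    nlinarith

/-- A one-sided form of the Donsker-Varadhan inequality with a test function bounded above. -/
theorem ofReal_add_one_le_klDiv_add [IsProbabilityMeasure μ] [IsProbabilityMeasure ν] (C : ℝ)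
    {H : α → ℝ} (hH : Measurable H) (hH0 : ∀ y, 0 ≤ H y) :
    ENNReal.ofReal (C + 1) ≤ klDiv μ ν + ∫⁻ y, ENNReal.ofReal (Real.exp (C - H y)) ∂ν +
      ∫⁻ y, ENNReal.ofReal (H y) ∂μ := by
  by_cases hac : μ ≪ ν
  swap
  · simp [klDiv_of_not_ac hac]
  have hF : Measurable (μ.rnDeriv ν) := Measure.measurable_rnDeriv _ _
  have hFi : Integrable (fun y => (μ.rnDeriv ν y).toReal) ν := Measure.integrable_toReal_rnDeriv
  have hF1 : ∫ y, (μ.rnDeriv ν y).toReal ∂ν = 1 := by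
    rw [Measure.integral_toReal_rnDeriv hac]; simp
  have hint : Integrable (fun y => C * (μ.rnDeriv ν y).toReal + 1) ν :=
    (hFi.const_mul C).add (integrable_const _)
  have e1 : C + 1 = ∫ y, (C * (μ.rnDeriv ν y).toReal + 1) ∂ν := by
    rw [integral_add (hFi.const_mul C) (integrable_const _), integral_const_mul, hF1]; simp
  have e2 : ∫⁻ y, ENNReal.ofReal (H y) ∂μ =
      ∫⁻ y, μ.rnDeriv ν y * ENNReal.ofReal (H y) ∂ν := by
    rw [← lintegral_rnDeriv_mul hac hH.ennreal_ofReal.aemeasurable]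
  rw [klDiv_eq_lintegral_klFun_of_ac hac, e2, ← lintegral_add_left (by fun_prop),
    ← lintegral_add_left (by fun_prop), e1]
  refine (ofReal_integral_le_lintegral hint).trans (lintegral_mono_ae ?_)
  filter_upwards [Measure.rnDeriv_lt_top μ ν] with y hy
  rw [← ENNReal.ofReal_toReal hy.ne, ENNReal.toReal_ofReal ENNReal.toReal_nonneg,
    ← ENNReal.ofReal_mul ENNReal.toReal_nonneg,
    ← ENNReal.ofReal_add (klFun_nonneg ENNReal.toReal_nonneg) (Real.exp_pos _).le,
    ← ENNReal.ofReal_add (add_nonneg (klFun_nonneg ENNReal.toReal_nonneg) (Real.exp_pos _).le)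
      (mul_nonneg ENNReal.toReal_nonneg (hH0 y))]
  refine ENNReal.ofReal_le_ofReal ?_
  have := mul_le_klFun_add_exp (ENNReal.toReal_nonneg (a := μ.rnDeriv ν y)) (C - H y)
  nlinarith

end KL

/-! ### Univariate Gaussian facts -/

/-- The likelihood ratio of `N(u, v)` against `N(0, v)` at `x`. -/
noncomputable def likRatio (v : ℝ≥0) (u x : ℝ) : ℝ := Real.exp (u * x / v - u ^ 2 / (2 * v))

theorem likRatio_pos (v : ℝ≥0) (u x : ℝ) : 0 < likRatio v u x := Real.exp_pos _

theorem measurable_likRatio (v : ℝ≥0) (u : ℝ) : Measurable (likRatio v u) := by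
  unfold likRatio; fun_prop

theorem gaussianPDFReal_eq_mul_likRatio (v : ℝ≥0) (u x : ℝ) :
    gaussianPDFReal u v x = gaussianPDFReal 0 v x * likRatio v u x := by
  rw [gaussianPDFReal, gaussianPDFReal, likRatio, mul_assoc (√_)⁻¹, ← Real.exp_add]
  congr 2
  ring

theorem gaussianPDF_eq_mul_likRatio (v : ℝ≥0) (u x : ℝ) :
    gaussianPDF u v x = gaussianPDF 0 v x * ENNReal.ofReal (likRatio v u x) := by
  rw [gaussianPDF, gaussianPDF, gaussianPDFReal_eq_mul_likRatio,
    ENNReal.ofReal_mul (gaussianPDFReal_nonneg _ _ _)]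

theorem lintegral_likRatio {v : ℝ≥0} (hv : v ≠ 0) (u : ℝ) :
    ∫⁻ x, ENNReal.ofReal (likRatio v u x) ∂(gaussianReal 0 v) = 1 := by
  rw [gaussianReal_of_var_ne_zero _ hv,
    lintegral_withDensity_eq_lintegral_mul _ (measurable_gaussianPDF _ _)
      (measurable_likRatio v u).ennreal_ofReal, ← lintegral_gaussianPDF_eq_one u hv]
  exact lintegral_congr fun x => (gaussianPDF_eq_mul_likRatio v u x).symm

theorem integrable_sq_sub_gaussianReal (θ : ℝ) (v : ℝ≥0) :
    Integrable (fun x => (x - θ) ^ 2) (gaussianReal θ v) :=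
  ((memLp_id_gaussianReal 2).sub (memLp_const θ)).integrable_sq

theorem integral_sq_sub_gaussianReal (θ : ℝ) (v : ℝ≥0) :
    ∫ x, (x - θ) ^ 2 ∂(gaussianReal θ v) = v := by
  have h := variance_fun_id_gaussianReal (μ := θ) (v := v)
  rwa [variance_eq_integral (by fun_prop), integral_id_gaussianReal] at h

theorem integrable_id_gaussianReal (θ : ℝ) (v : ℝ≥0) :
    Integrable (fun x => x) (gaussianReal θ v) :=
  (memLp_id_gaussianReal 1).integrable le_rfl

theorem integrable_abs_sub_gaussianReal (θ : ℝ) (v : ℝ≥0) :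
    Integrable (fun x => |x - θ|) (gaussianReal θ v) :=
  ((integrable_id_gaussianReal θ v).sub (integrable_const θ)).abs

/-- With `A` the mean of `|X - θ|`, the variance of `|X - θ|` is `v - A²`, which is nonnegative. -/
theorem integral_abs_sub_gaussianReal_le (θ : ℝ) (v : ℝ≥0) :
    ∫ x, |x - θ| ∂(gaussianReal θ v) ≤ √v := by
  set A := ∫ x, |x - θ| ∂(gaussianReal θ v) with hA
  have h0 : 0 ≤ ∫ x, (|x - θ| - A) ^ 2 ∂(gaussianReal θ v) :=
    integral_nonneg fun x => sq_nonneg _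
  have hi := integrable_abs_sub_gaussianReal θ v
  have h2 := integrable_sq_sub_gaussianReal θ v
  have e : ∫ x, (|x - θ| - A) ^ 2 ∂(gaussianReal θ v) = v - A ^ 2 := by
    have : ∀ x, (|x - θ| - A) ^ 2 = (x - θ) ^ 2 - 2 * A * |x - θ| + A ^ 2 := fun x => by
      rw [sub_sq, sq_abs]; ring
    simp_rw [this]
    have h3 : Integrable (fun x => (x - θ) ^ 2 - 2 * A * |x - θ|) (gaussianReal θ v) :=
      h2.sub (hi.const_mul _)
    rw [integral_add h3 (integrable_const _), integral_sub h2 (hi.const_mul _), integral_sq_sub_gaussianReal, integral_const_mul, ← hA]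
    simp
    ring
  exact Real.le_sqrt_of_sq_le (by linarith)

theorem lintegral_abs_sub_gaussianReal_le (θ : ℝ) (v : ℝ≥0) :
    ∫⁻ x, ENNReal.ofReal |x - θ| ∂(gaussianReal θ v) ≤ ENNReal.ofReal √v := by
  rw [← ofReal_integral_eq_lintegral_ofReal (integrable_abs_sub_gaussianReal θ v)
    (ae_of_all _ fun x => abs_nonneg _)]
  exact ENNReal.ofReal_le_ofReal (integral_abs_sub_gaussianReal_le θ v)

theorem lintegral_eval_gaussianLaw {n : ℕ} {v : ℝ≥0} (hv : v ≠ 0) (θ : Fin n → ℝ) (i : Fin n)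
    {f : ℝ → ℝ≥0∞} (hf : Measurable f) :
    ∫⁻ x, f (x i) ∂(gaussianLaw v θ) = ∫⁻ x, f x ∂(gaussianReal (θ i) v) := by
  rw [gaussianLaw_eq_pi hv]
  exact (measurePreserving_eval (fun i => gaussianReal (θ i) v) i).lintegral_comp hf

/-! ### The lower bound: one spike in each of `k` blocks of `m` coordinates -/

section LowerBound

variable {n k m : ℕ} (e : Fin k × Fin m ↪ Fin n) (a : ℝ)

open Classical in
/-- The parameter with a spike of height `a` at position `J b` of each block `b`. -/
noncomputable def blockSpike (J : Fin k → Fin m) (i : Fin n) : ℝ :=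
  if ∃ b, e (b, J b) = i then a else 0

theorem blockSpike_apply_self (J : Fin k → Fin m) (b : Fin k) :
    blockSpike e a J (e (b, J b)) = a := if_pos ⟨b, rfl⟩

theorem blockSpike_apply_of_ne (J : Fin k → Fin m) {b : Fin k} {j : Fin m} (h : j ≠ J b) :
    blockSpike e a J (e (b, j)) = 0 := by
  refine if_neg ?_
  rintro ⟨b', hb'⟩
  have := e.injective hb'
  simp only [Prod.mk.injEq] at this
  obtain ⟨rfl, h2⟩ := this
  exact h h2.symm

theorem hammingNorm_blockSpike_le (J : Fin k → Fin m) : hammingNorm (blockSpike e a J) ≤ k := by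
  classical
  have : (Finset.univ.filter fun i => blockSpike e a J i ≠ 0) ⊆
      Finset.univ.image fun b => e (b, J b) := by
    intro i hi
    simp only [blockSpike, ne_eq, ite_eq_right_iff, Classical.not_imp, Finset.mem_filter] at hi
    simpa using hi.2.1
  exact (Finset.card_le_card this).trans (Finset.card_image_le.trans (by simp))

theorem blockSpike_mem_sparseSet {s t : ℝ} (hk : (k : ℝ) ≤ s) (ha : 0 ≤ a) (hat : a ≤ t)
    (J : Fin k → Fin m) : blockSpike e a J ∈ sparseSet n s t := by
  refine ⟨(Nat.cast_le.2 (hammingNorm_blockSpike_le e a J)).trans hk, fun i => ?_⟩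
  unfold blockSpike
  split_ifs
  · rwa [abs_of_nonneg ha]
  · simpa using ha.trans hat

theorem gaussianDensity_blockSpike (v : ℝ≥0) (J : Fin k → Fin m) (x : Fin n → ℝ) :
    gaussianDensity v (blockSpike e a J) x =
      gaussianDensity v 0 x * ∏ b, ENNReal.ofReal (likRatio v a (x (e (b, J b)))) := by
  classical
  have h1 : ∀ i, gaussianPDF (blockSpike e a J i) v (x i) = gaussianPDF 0 v (x i) *
      if ∃ b, e (b, J b) = i then ENNReal.ofReal (likRatio v a (x i)) else 1 := by
    intro i
    unfold blockSpike
    split_ifs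
    · exact gaussianPDF_eq_mul_likRatio _ _ _
    · rw [mul_one]
  have hinj : Function.Injective fun b => e (b, J b) := fun b b' h =>
    congrArg Prod.fst (e.injective h)
  have himg : (Finset.univ.filter fun i => ∃ b, e (b, J b) = i) =
      Finset.univ.image fun b => e (b, J b) := by ext; simp
  simp_rw [gaussianDensity, h1, Finset.prod_mul_distrib, ← Finset.prod_filter, himg,
    Finset.prod_image hinj.injOn]
  rfl

/-- The penalty paid by a block with data `x, y` and spike at position `j`. -/
noncomputable def blockPenalty (r : ℝ≥0) (x y : Fin m → ℝ) (j : Fin m) : ℝ :=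
  a * |x j - a| + a / r * |y j - a| +
    (∑ l ∈ Finset.univ.erase j, likRatio 1 a (x l) * likRatio r a (y l)) / m

theorem blockPenalty_nonneg {a : ℝ} (ha : 0 ≤ a) (r : ℝ≥0) (x y : Fin m → ℝ) (j : Fin m) :
    0 ≤ blockPenalty a r x y j := by
  unfold blockPenalty
  have := Finset.sum_nonneg fun l (_ : l ∈ Finset.univ.erase j) =>
    (mul_pos (likRatio_pos 1 a (x l)) (likRatio_pos r a (y l))).le
  positivity

/-- The right side is `m` times the posterior probability of position `j` given `x` and `y`. Its
denominator is `L j + m w`, with `w` the sum of the other ratios divided by `m`. Both `L j` and `m`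
are at most a common `X`, so the denominator is at most `X (1 + w) ≤ X exp w`; the penalty consists
of `w` and the two deviation terms inside `X`. -/
theorem likRatio_mul_exp_sub_blockPenalty_le {a : ℝ} (ha : 0 ≤ a) {r : ℝ≥0} (hr : 0 < r)
    (hm : a ^ 2 / 2 + a ^ 2 / (2 * r) = Real.log m) (x y : Fin m → ℝ) (j : Fin m) :
    likRatio 1 a (x j) * Real.exp (Real.log m - a ^ 2 / 2 - blockPenalty a r x y j) ≤
      m * (likRatio 1 a (x j) * likRatio r a (y j) /
        ∑ l, likRatio 1 a (x l) * likRatio r a (y l)) := by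
  have hm0 : (0 : ℝ) < m := Nat.cast_pos.2 (Fin.pos_iff_nonempty.2 ⟨j⟩)
  have hr' : (0 : ℝ) < r := hr
  set L : Fin m → ℝ := fun l => likRatio 1 a (x l) * likRatio r a (y l) with hL
  have hLpos : ∀ l, 0 < L l := fun l => mul_pos (likRatio_pos _ _ _) (likRatio_pos _ _ _)
  set w : ℝ := (∑ l ∈ Finset.univ.erase j, L l) / m with hw
  have hw0 : 0 ≤ w := div_nonneg (Finset.sum_nonneg fun l _ => (hLpos l).le) hm0.le
  have hsum : ∑ l, L l = L j + m * w := by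
    rw [hw, mul_div_cancel₀ _ hm0.ne', Finset.add_sum_erase _ _ (Finset.mem_univ j)]
  have hsum0 : 0 < ∑ l, L l := by
    rw [hsum]; exact add_pos_of_pos_of_nonneg (hLpos j) (mul_nonneg hm0.le hw0)
  set X : ℝ := likRatio r a (y j) * Real.exp (a ^ 2 / 2 + a * |x j - a| + a / r * |y j - a|)
    with hX
  have hX0 : 0 < X := mul_pos (likRatio_pos _ _ _) (Real.exp_pos _)
  have hy0 : 0 ≤ a / r * |y j - a| := by positivity
  have hx0 : 0 ≤ a * |x j - a| := by positivity
  have hLX : L j ≤ X := by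
    rw [hX, show L j = likRatio r a (y j) * likRatio 1 a (x j) from mul_comm _ _]
    refine mul_le_mul_of_nonneg_left ?_ (likRatio_pos _ _ _).le
    refine Real.exp_le_exp.2 ?_
    have : a * (x j - a) ≤ a * |x j - a| := mul_le_mul_of_nonneg_left (le_abs_self _) ha
    simp only [NNReal.coe_one]
    linarith
  -- The calibration of `a` enters here: at `y j = a` the ratio `likRatio r a (y j)` is `exp (a² /
  -- (2r))`, and times `exp (a² / 2)` this is exactly `m`.
  have hmX : (m : ℝ) ≤ X := by
    rw [hX, likRatio, ← Real.exp_add]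
    refine (Real.log_le_iff_le_exp hm0).1 ?_
    have : a / r * (a - y j) ≤ a / r * |y j - a| := by
      refine mul_le_mul_of_nonneg_left ?_ (by positivity)
      rw [abs_sub_comm]; exact le_abs_self _
    have e1 : a / r * (a - y j) = 2 * (a ^ 2 / (2 * r)) - a * y j / r := by
      field_simp
    linarith
  have key : ∑ l, L l ≤ X * Real.exp w := by
    rw [hsum]
    nlinarith [Real.add_one_le_exp w, mul_le_mul_of_nonneg_right hmX hw0]
  have e2 : Real.exp (Real.log m - a ^ 2 / 2 - blockPenalty a r x y j) * (X * Real.exp w) =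
      m * likRatio r a (y j) := by
    rw [hX, mul_assoc (likRatio r a (y j)), ← Real.exp_add, mul_left_comm, ← Real.exp_add,
      mul_comm (m : ℝ)]
    congr 1
    conv_rhs => rw [← Real.exp_log hm0]
    congr 1
    rw [blockPenalty, hw]
    ring
  rw [← mul_div_assoc, le_div_iff₀ hsum0, mul_assoc, mul_left_comm (m : ℝ)]
  refine mul_le_mul_of_nonneg_left ?_ (likRatio_pos _ _ _).le
  calc _ ≤ _ := mul_le_mul_of_nonneg_left key (Real.exp_pos _).le
    _ = _ := e2

theorem sum_prod_likRatio_mul_exp_le {a : ℝ} (ha : 0 ≤ a) {r : ℝ≥0} (hr : 0 < r)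
    (hm0 : m ≠ 0) (hm : a ^ 2 / 2 + a ^ 2 / (2 * r) = Real.log m)
    (x y : Fin k → Fin m → ℝ) :
    ∑ J : Fin k → Fin m, (∏ b, likRatio 1 a (x b (J b))) *
        Real.exp (k * (Real.log m - a ^ 2 / 2) - ∑ b, blockPenalty a r (x b) (y b) (J b)) ≤
      (m : ℝ) ^ k := by
  have h1 : ∀ J : Fin k → Fin m, (∏ b, likRatio 1 a (x b (J b))) *
      Real.exp (k * (Real.log m - a ^ 2 / 2) - ∑ b, blockPenalty a r (x b) (y b) (J b)) =
      ∏ b, likRatio 1 a (x b (J b)) *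
        Real.exp (Real.log m - a ^ 2 / 2 - blockPenalty a r (x b) (y b) (J b)) := by
    intro J
    rw [Finset.prod_mul_distrib, ← Real.exp_sum, Finset.sum_sub_distrib]
    simp [mul_sub]
  simp_rw [h1]
  -- The summand factors over blocks, so the sum over all choices of positions is a product of block
  -- sums, each at most `m`.
  rw [← Fintype.piFinset_univ, ← Finset.prod_univ_sum (fun _ => Finset.univ)
    (fun b j => likRatio 1 a (x b j) *
      Real.exp (Real.log m - a ^ 2 / 2 - blockPenalty a r (x b) (y b) j))]
  have h2 : ∀ b : Fin k, ∑ j, likRatio 1 a (x b j) *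
      Real.exp (Real.log m - a ^ 2 / 2 - blockPenalty a r (x b) (y b) j) ≤ m := by
    intro b
    refine (Finset.sum_le_sum fun j _ =>
      likRatio_mul_exp_sub_blockPenalty_le ha hr hm (x b) (y b) j).trans ?_
    rw [← Finset.mul_sum, ← Finset.sum_div, div_self, mul_one]
    have : Nonempty (Fin m) := Fin.pos_iff_nonempty.1 (Nat.pos_of_ne_zero hm0)
    exact (Finset.sum_pos (fun j _ => mul_pos (likRatio_pos _ _ _) (likRatio_pos _ _ _))
      Finset.univ_nonempty).ne'
  refine (Finset.prod_le_prod (fun b _ => Finset.sum_nonneg fun j _ =>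
    mul_nonneg (likRatio_pos _ _ _).le (Real.exp_pos _).le) fun b _ => h2 b).trans ?_
  simp

/-- The sum over the blocks of the penalties for spikes at the positions `J`. -/
noncomputable def totalPenalty (r : ℝ≥0) (J : Fin k → Fin m) (x y : Fin n → ℝ) : ℝ :=
  ∑ b, blockPenalty a r (fun j => x (e (b, j))) (fun j => y (e (b, j))) (J b)

theorem totalPenalty_nonneg {a : ℝ} (ha : 0 ≤ a) (r : ℝ≥0) (J : Fin k → Fin m)
    (x y : Fin n → ℝ) : 0 ≤ totalPenalty e a r J x y :=
  Finset.sum_nonneg fun _ _ => blockPenalty_nonneg ha _ _ _ _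

theorem measurable_totalPenalty (r : ℝ≥0) (J : Fin k → Fin m) :
    Measurable fun z : (Fin n → ℝ) × (Fin n → ℝ) => totalPenalty e a r J z.1 z.2 := by
  unfold totalPenalty blockPenalty likRatio
  fun_prop

/-! ### Averaging the Donsker-Varadhan bound over spike positions. -/

theorem isProbabilityMeasure_withDensity_of_isPDE {q : (Fin n → ℝ) → (Fin n → ℝ) → ℝ≥0∞}
    (hq : IsPDE q) (x : Fin n → ℝ) : IsProbabilityMeasure (volume.withDensity (q x)) :=
  ⟨by rw [withDensity_apply _ MeasurableSet.univ, Measure.restrict_univ, hq.lintegral_eq_one]⟩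

/-- The exponential term is written against Lebesgue measure, with the density in `x` explicit, so
that it can be summed over different `θ` for a fixed `q`. -/
theorem ofReal_add_one_le_risk_add {r : ℝ≥0} (hr : 0 < r)
    {q : (Fin n → ℝ) → (Fin n → ℝ) → ℝ≥0∞} (hq : IsPDE q) (θ : Fin n → ℝ) (C : ℝ)
    {H : (Fin n → ℝ) → (Fin n → ℝ) → ℝ} (hH : Measurable (Function.uncurry H))
    (hH0 : ∀ x y, 0 ≤ H x y) :
    ENNReal.ofReal (C + 1) ≤ risk r θ q +
      (∫⁻ x, ∫⁻ y, gaussianDensity 1 θ x * ENNReal.ofReal (Real.exp (C - H x y)) * q x y) +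
      ∫⁻ x, ∫⁻ y, ENNReal.ofReal (H x y) ∂(gaussianLaw r θ) ∂(gaussianLaw 1 θ) := by
  have := isProbabilityMeasure_gaussianLaw (one_ne_zero (α := ℝ≥0)) θ
  have := isProbabilityMeasure_gaussianLaw hr.ne' θ
  have hHx : ∀ x, Measurable (H x) := fun x => hH.comp measurable_prodMk_left
  have hqx : ∀ x, Measurable (q x) := fun x => hq.measurable.comp measurable_prodMk_left
  have hE : Measurable (Function.uncurry fun x y => ENNReal.ofReal (Real.exp (C - H x y))) :=
    (Real.measurable_exp.comp (measurable_const.sub hH)).ennreal_ofReal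
  have hEq : Measurable (Function.uncurry fun x y =>
      ENNReal.ofReal (Real.exp (C - H x y)) * q x y) := hE.mul hq.measurable
  have hA : Measurable fun x => ∫⁻ y, ENNReal.ofReal (Real.exp (C - H x y)) * q x y :=
    hEq.lintegral_prod_right'
  have hB : Measurable fun x => ∫⁻ y, ENNReal.ofReal (H x y) ∂(gaussianLaw r θ) :=
    hH.ennreal_ofReal.lintegral_prod_right'
  have e1 : ∫⁻ x, ∫⁻ y, gaussianDensity 1 θ x * ENNReal.ofReal (Real.exp (C - H x y)) * q x y =
      ∫⁻ x, (∫⁻ y, ENNReal.ofReal (Real.exp (C - H x y)) * q x y) ∂(gaussianLaw 1 θ) := by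
    rw [gaussianLaw, lintegral_withDensity_eq_lintegral_mul _ (measurable_gaussianDensity 1 θ) hA]
    refine lintegral_congr fun x => ?_
    simp_rw [mul_assoc]
    exact lintegral_const_mul _ (hEq.comp measurable_prodMk_left)
  rw [e1, risk, ← lintegral_add_right _ hA, ← lintegral_add_right _ hB]
  calc ENNReal.ofReal (C + 1) = ∫⁻ _, ENNReal.ofReal (C + 1) ∂(gaussianLaw 1 θ) := by simp
    _ ≤ _ := lintegral_mono fun x => ?_
  have := isProbabilityMeasure_withDensity_of_isPDE hq x
  refine (ofReal_add_one_le_klDiv_add (μ := gaussianLaw r θ) (ν := volume.withDensity (q x)) C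
    (hHx x) (hH0 x)).trans_eq ?_
  have hEx : Measurable fun y => ENNReal.ofReal (Real.exp (C - H x y)) :=
    hE.comp measurable_prodMk_left
  rw [lintegral_withDensity_eq_lintegral_mul _ (hqx x) hEx]
  simp only [Pi.mul_apply, mul_comm (q x _)]
  rfl

/-- The bound does not depend on `y`, so any predictive density `q x` integrates out of it. -/
theorem sum_gaussianDensity_mul_exp_le {a : ℝ} (ha : 0 ≤ a) {r : ℝ≥0} (hr : 0 < r)
    (hm0 : m ≠ 0) (hm : a ^ 2 / 2 + a ^ 2 / (2 * r) = Real.log m) (x y : Fin n → ℝ) :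
    ∑ J : Fin k → Fin m, gaussianDensity 1 (blockSpike e a J) x * ENNReal.ofReal
        (Real.exp (k * (Real.log m - a ^ 2 / 2) - totalPenalty e a r J x y)) ≤
      (m : ℝ≥0∞) ^ k * gaussianDensity 1 0 x := by
  have h1 : ∀ J : Fin k → Fin m, gaussianDensity 1 (blockSpike e a J) x * ENNReal.ofReal
        (Real.exp (k * (Real.log m - a ^ 2 / 2) - totalPenalty e a r J x y)) =
      gaussianDensity 1 0 x * ENNReal.ofReal ((∏ b, likRatio 1 a (x (e (b, J b)))) *
        Real.exp (k * (Real.log m - a ^ 2 / 2) - totalPenalty e a r J x y)) := by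
    intro J
    rw [gaussianDensity_blockSpike, ENNReal.ofReal_mul
      (Finset.prod_nonneg fun b _ => (likRatio_pos _ _ _).le),
      ENNReal.ofReal_prod_of_nonneg fun b _ => (likRatio_pos _ _ _).le, mul_assoc]
  have hnn : ∀ J : Fin k → Fin m, 0 ≤ (∏ b, likRatio 1 a (x (e (b, J b)))) *
        Real.exp (k * (Real.log m - a ^ 2 / 2) - totalPenalty e a r J x y) := fun J =>
    mul_nonneg (Finset.prod_nonneg fun b _ => (likRatio_pos _ _ _).le) (Real.exp_pos _).le
  simp_rw [h1]
  rw [← Finset.mul_sum, ← ENNReal.ofReal_sum_of_nonneg fun J _ => hnn J, mul_comm]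
  gcongr
  refine (ENNReal.ofReal_le_ofReal (sum_prod_likRatio_mul_exp_le ha hr hm0 hm
    (fun b j => x (e (b, j))) (fun b j => y (e (b, j))))).trans_eq ?_
  rw [ENNReal.ofReal_pow (Nat.cast_nonneg _), ENNReal.ofReal_natCast]

/-- The deviations have mean at most `1` for `x` and `√r` for `y`. Off the spike the coordinates are
centred, so each likelihood ratio has mean 1, and there are fewer than `m` of them, divided by `m`.
-/
theorem lintegral_blockPenalty_le {a : ℝ} (ha : 0 ≤ a) {r : ℝ≥0} (hr : 0 < r)
    (J : Fin k → Fin m) (b : Fin k) :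
    ∫⁻ x, ∫⁻ y, ENNReal.ofReal
        (blockPenalty a r (fun j => x (e (b, j))) (fun j => y (e (b, j))) (J b))
      ∂(gaussianLaw r (blockSpike e a J)) ∂(gaussianLaw 1 (blockSpike e a J)) ≤
      ENNReal.ofReal (a + a / √r + 1) := by
  have hm0 : (0 : ℝ) < m := Nat.cast_pos.2 (Fin.pos_iff_nonempty.2 ⟨J b⟩)
  have hr' : (0 : ℝ) < r := hr
  set θ := blockSpike e a J with hθ
  have := isProbabilityMeasure_gaussianLaw (one_ne_zero (α := ℝ≥0)) θ
  have := isProbabilityMeasure_gaussianLaw hr.ne' θ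
  have hL : ∀ (v : ℝ≥0) (i : Fin n), Measurable fun x : Fin n → ℝ =>
      ENNReal.ofReal (likRatio v a (x i)) := fun v i =>
    ((measurable_likRatio v a).comp (measurable_pi_apply i)).ennreal_ofReal
  have hP : ∀ c : ℝ, Measurable fun x : ℝ => ENNReal.ofReal c * ENNReal.ofReal |x - a| :=
    fun c => by fun_prop
  have hsplit : ∀ x y : Fin n → ℝ, ENNReal.ofReal
      (blockPenalty a r (fun j => x (e (b, j))) (fun j => y (e (b, j))) (J b)) =
      ENNReal.ofReal a * ENNReal.ofReal |x (e (b, J b)) - a| +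
      ENNReal.ofReal (a / r) * ENNReal.ofReal |y (e (b, J b)) - a| +
      ENNReal.ofReal (1 / m) * ∑ l ∈ Finset.univ.erase (J b),
        ENNReal.ofReal (likRatio 1 a (x (e (b, l)))) *
          ENNReal.ofReal (likRatio r a (y (e (b, l)))) := by
    intro x y
    have hs : ∀ l ∈ Finset.univ.erase (J b),
        0 ≤ likRatio 1 a (x (e (b, l))) * likRatio r a (y (e (b, l))) := fun l _ =>
      (mul_pos (likRatio_pos _ _ _) (likRatio_pos _ _ _)).le
    have hs' := Finset.sum_nonneg hs
    rw [blockPenalty, ENNReal.ofReal_add (by positivity) (by positivity),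
      ENNReal.ofReal_add (by positivity) (by positivity), ENNReal.ofReal_mul ha,
      ENNReal.ofReal_mul (by positivity), div_eq_inv_mul _ (m : ℝ), ← one_div,
      ENNReal.ofReal_mul (by positivity), ENNReal.ofReal_sum_of_nonneg hs]
    simp_rw [ENNReal.ofReal_mul (likRatio_pos _ _ _).le]
  have hsum : ∀ x : Fin n → ℝ, Measurable fun y : Fin n → ℝ =>
      ∑ l ∈ Finset.univ.erase (J b), ENNReal.ofReal (likRatio 1 a (x (e (b, l)))) *
          ENNReal.ofReal (likRatio r a (y (e (b, l)))) := fun x =>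
    Finset.measurable_fun_sum _ fun l _ => (hL r _).const_mul _
  have hLy : ∀ l ∈ Finset.univ.erase (J b), ∀ v : ℝ≥0, v ≠ 0 →
      ∫⁻ y, ENNReal.ofReal (likRatio v a (y (e (b, l)))) ∂(gaussianLaw v θ) = 1 := by
    intro l hl v hv
    rw [lintegral_eval_gaussianLaw hv θ (e (b, l)) (measurable_likRatio v a).ennreal_ofReal,
      hθ, blockSpike_apply_of_ne e a J (Finset.ne_of_mem_erase hl), lintegral_likRatio hv]
  have hθb : θ (e (b, J b)) = a := blockSpike_apply_self e a J b
  have hy : ∀ x : Fin n → ℝ, ∫⁻ y, ENNReal.ofReal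
      (blockPenalty a r (fun j => x (e (b, j))) (fun j => y (e (b, j))) (J b))
      ∂(gaussianLaw r θ) ≤
      ENNReal.ofReal a * ENNReal.ofReal |x (e (b, J b)) - a| + ENNReal.ofReal (a / √r) +
      ENNReal.ofReal (1 / m) * ∑ l ∈ Finset.univ.erase (J b),
        ENNReal.ofReal (likRatio 1 a (x (e (b, l)))) := by
    intro x
    simp_rw [hsplit]
    rw [lintegral_add_right _ ((hsum x).const_mul _), lintegral_add_left measurable_const,
      lintegral_const_mul _ (hsum x), lintegral_finsetSum _ fun l _ => (hL r _).const_mul _]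
    refine add_le_add (add_le_add (by simp) ?_) (mul_le_mul_right (Finset.sum_le_sum fun l hl => ?_) _)
    · rw [lintegral_eval_gaussianLaw hr.ne' θ (e (b, J b)) (hP _), hθb,
        lintegral_const_mul _ (by fun_prop)]
      refine (mul_le_mul_right (lintegral_abs_sub_gaussianReal_le a r) _).trans_eq ?_
      rw [← ENNReal.ofReal_mul (by positivity)]
      congr 1
      rw [div_mul_eq_mul_div, mul_div_assoc, Real.sqrt_div_self', mul_one_div]
    · rw [lintegral_const_mul _ (hL r _), hLy l hl r hr.ne', mul_one]
  refine (lintegral_mono hy).trans ?_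
  have hsum1 : Measurable fun x : Fin n → ℝ =>
      ∑ l ∈ Finset.univ.erase (J b), ENNReal.ofReal (likRatio 1 a (x (e (b, l)))) :=
    Finset.measurable_fun_sum _ fun l _ => hL 1 _
  rw [lintegral_add_right _ (hsum1.const_mul _), lintegral_add_right _ measurable_const,
      lintegral_const_mul _ hsum1, lintegral_finsetSum _ fun l _ => hL 1 _,
      lintegral_eval_gaussianLaw one_ne_zero θ (e (b, J b)) (hP _), hθb,
      lintegral_const_mul _ (by fun_prop), ENNReal.ofReal_add (by positivity) zero_le_one,
      ENNReal.ofReal_add ha (by positivity)]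
  refine add_le_add (add_le_add ?_ (by simp)) ?_
  · refine (mul_le_mul_right (lintegral_abs_sub_gaussianReal_le a 1) _).trans_eq ?_
    simp
  · rw [Finset.sum_congr rfl fun l hl => hLy l hl 1 one_ne_zero]
    simp only [Finset.sum_const, nsmul_eq_mul, mul_one]
    rw [← ENNReal.ofReal_natCast, ← ENNReal.ofReal_mul (by positivity)]
    refine ENNReal.ofReal_le_ofReal ?_
    rw [one_div, inv_mul_le_iff₀ hm0, mul_one, Nat.cast_le]
    exact (Finset.card_le_univ _).trans (by simp)

theorem lintegral_totalPenalty_le {a : ℝ} (ha : 0 ≤ a) {r : ℝ≥0} (hr : 0 < r)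
    (J : Fin k → Fin m) :
    ∫⁻ x, ∫⁻ y, ENNReal.ofReal (totalPenalty e a r J x y)
      ∂(gaussianLaw r (blockSpike e a J)) ∂(gaussianLaw 1 (blockSpike e a J)) ≤
      ENNReal.ofReal (k * (a + a / √r + 1)) := by
  have := isProbabilityMeasure_gaussianLaw hr.ne' (blockSpike e a J)
  have hmeas : ∀ b : Fin k, Measurable fun z : (Fin n → ℝ) × (Fin n → ℝ) => ENNReal.ofReal
      (blockPenalty a r (fun j => z.1 (e (b, j))) (fun j => z.2 (e (b, j))) (J b)) := by
    intro b
    unfold blockPenalty likRatio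
    fun_prop
  have h1 : ∀ x y : Fin n → ℝ, ENNReal.ofReal (totalPenalty e a r J x y) = ∑ b, ENNReal.ofReal
      (blockPenalty a r (fun j => x (e (b, j))) (fun j => y (e (b, j))) (J b)) := fun x y =>
    ENNReal.ofReal_sum_of_nonneg fun _ _ => blockPenalty_nonneg ha _ _ _ _
  have h2 : ∀ x : Fin n → ℝ, ∫⁻ y, ENNReal.ofReal (totalPenalty e a r J x y)
      ∂(gaussianLaw r (blockSpike e a J)) = ∑ b, ∫⁻ y, ENNReal.ofReal
      (blockPenalty a r (fun j => x (e (b, j))) (fun j => y (e (b, j))) (J b))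
      ∂(gaussianLaw r (blockSpike e a J)) := by
    intro x
    simp_rw [h1]
    exact lintegral_finsetSum _ fun b _ => (hmeas b).comp measurable_prodMk_left
  simp_rw [h2]
  rw [lintegral_finsetSum _ fun b _ => (hmeas b).lintegral_prod_right']
  refine (Finset.sum_le_sum fun b _ => lintegral_blockPenalty_le e ha hr J b).trans_eq ?_
  rw [Finset.sum_const, nsmul_eq_mul, ENNReal.ofReal_mul (Nat.cast_nonneg _),
    ENNReal.ofReal_natCast]
  simp

theorem sum_lintegral_exp_le {a : ℝ} (ha : 0 ≤ a) {r : ℝ≥0} (hr : 0 < r)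
    (hm0 : m ≠ 0) (hm : a ^ 2 / 2 + a ^ 2 / (2 * r) = Real.log m)
    {q : (Fin n → ℝ) → (Fin n → ℝ) → ℝ≥0∞} (hq : IsPDE q) :
    ∑ J : Fin k → Fin m, ∫⁻ x, ∫⁻ y, gaussianDensity 1 (blockSpike e a J) x * ENNReal.ofReal
        (Real.exp (k * (Real.log m - a ^ 2 / 2) - totalPenalty e a r J x y)) * q x y ≤
      (m : ℝ≥0∞) ^ k := by
  have hmeas : ∀ J : Fin k → Fin m, Measurable fun z : (Fin n → ℝ) × (Fin n → ℝ) =>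
      gaussianDensity 1 (blockSpike e a J) z.1 * ENNReal.ofReal
        (Real.exp (k * (Real.log m - a ^ 2 / 2) - totalPenalty e a r J z.1 z.2)) * q z.1 z.2 :=
    fun J => (((measurable_gaussianDensity 1 _).comp measurable_fst).mul
      (Real.measurable_exp.comp (measurable_const.sub
        (measurable_totalPenalty e a r J))).ennreal_ofReal).mul hq.measurable
  rw [← lintegral_finsetSum _ fun J _ => (hmeas J).lintegral_prod_right']
  calc _ ≤ ∫⁻ x, ∫⁻ y, ((m : ℝ≥0∞) ^ k * gaussianDensity 1 0 x) * q x y := by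
        refine lintegral_mono fun x => ?_
        refine (lintegral_finsetSum _ fun J _ =>
          (hmeas J).comp measurable_prodMk_left).symm.trans_le ?_
        refine lintegral_mono fun y => ?_
        refine (Finset.sum_mul _ _ _).symm.trans_le ?_
        gcongr
        exact sum_gaussianDensity_mul_exp_le e ha hr hm0 hm x y
    _ = (m : ℝ≥0∞) ^ k := by
        have : ∀ x, ∫⁻ y, ((m : ℝ≥0∞) ^ k * gaussianDensity 1 0 x) * q x y =
            (m : ℝ≥0∞) ^ k * gaussianDensity 1 0 x := fun x => by
          have hqx : Measurable (q x) := hq.measurable.comp measurable_prodMk_left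
          rw [lintegral_const_mul _ hqx, hq.lintegral_eq_one, mul_one]
        simp_rw [this]
        rw [lintegral_const_mul _ (measurable_gaussianDensity 1 0),
          lintegral_gaussianDensity one_ne_zero, mul_one]

/-- The minimax lower bound obtained from one spike of height `a` in each of `k` blocks. -/
theorem ofReal_le_minimaxRisk {a : ℝ} (ha : 0 ≤ a) {r : ℝ≥0} (hr : 0 < r)
    (hm0 : m ≠ 0) (hm : a ^ 2 / 2 + a ^ 2 / (2 * r) = Real.log m) (hkm : k * m ≤ n) {s t : ℝ}
    (hk : (k : ℝ) ≤ s) (hat : a ≤ t) :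
    ENNReal.ofReal (k * (Real.log m - a ^ 2 / 2 - (a + a / √r + 1))) ≤
      minimaxRisk r (sparseSet n s t) := by
  obtain ⟨e⟩ : Nonempty (Fin k × Fin m ↪ Fin n) :=
    Function.Embedding.nonempty_of_card_le (by simpa using hkm)
  refine le_iInf₂ fun q hq => ?_
  set C : ℝ := k * (Real.log m - a ^ 2 / 2) with hC
  set B : ℝ := k * (a + a / √r + 1) with hB
  have hB0 : 0 ≤ B := by positivity
  set R := maxRisk r (sparseSet n s t) q with hR
  have h1 : ∀ J : Fin k → Fin m, ENNReal.ofReal (C + 1) ≤ R +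
      (∫⁻ x, ∫⁻ y, gaussianDensity 1 (blockSpike e a J) x * ENNReal.ofReal
        (Real.exp (C - totalPenalty e a r J x y)) * q x y) + ENNReal.ofReal B := by
    intro J
    refine (ofReal_add_one_le_risk_add hr hq (blockSpike e a J) C
      (H := totalPenalty e a r J) (measurable_totalPenalty e a r J)
      (totalPenalty_nonneg e ha r J)).trans ?_
    gcongr
    · exact le_iSup₂ (f := fun θ _ => risk r θ q) _ (blockSpike_mem_sparseSet e a hk ha hat J)
    · exact lintegral_totalPenalty_le e ha hr J
  have h2 := Finset.sum_le_sum fun (J : Fin k → Fin m) (_ : J ∈ Finset.univ) => h1 J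
  simp only [Finset.sum_add_distrib, Finset.sum_const, Finset.card_univ, Fintype.card_fun,
    Fintype.card_fin, nsmul_eq_mul, Nat.cast_pow] at h2
  have h3 : (m : ℝ≥0∞) ^ k * ENNReal.ofReal (C + 1) ≤
      (m : ℝ≥0∞) ^ k * (R + 1 + ENNReal.ofReal B) := by
    refine h2.trans ?_
    rw [mul_add, mul_add, mul_one]
    gcongr
    exact sum_lintegral_exp_le e ha hr hm0 hm hq
  have h4 : ENNReal.ofReal (C + 1) ≤ R + 1 + ENNReal.ofReal B :=
    (ENNReal.mul_le_mul_iff_right (pow_ne_zero _ (Nat.cast_ne_zero.2 hm0))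
      (ENNReal.pow_ne_top (ENNReal.natCast_ne_top m))).1 h3
  -- The `+ 1` in the Donsker-Varadhan inequality cancels the bound 1 for the averaged exponential
  -- term.
  have e5 : k * (Real.log m - a ^ 2 / 2 - (a + a / √r + 1)) = C + 1 - (1 + B) := by
    rw [hC, hB]; ring
  rw [e5, ENNReal.ofReal_sub _ (by positivity), ENNReal.ofReal_add zero_le_one hB0,
    ENNReal.ofReal_one]
  exact tsub_le_iff_right.2 (h4.trans_eq (add_assoc _ _ _))

end LowerBound

/-! ### Bayes predictive densities for product priors -/

/-- The marginal density of one observation under the prior `π`. -/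
noncomputable def marginal (π : Measure ℝ) (x : ℝ) : ℝ≥0∞ := ∫⁻ u, gaussianPDF u 1 x ∂π

/-- The joint density of a past and a future observation under the prior `π`. -/
noncomputable def jointMarginal (r : ℝ≥0) (π : Measure ℝ) (x y : ℝ) : ℝ≥0∞ :=
  ∫⁻ u, gaussianPDF u 1 x * gaussianPDF u r y ∂π

theorem measurable_gaussianPDF_mean (v : ℝ≥0) (x : ℝ) : Measurable fun u => gaussianPDF u v x := by
  unfold gaussianPDF gaussianPDFReal
  fun_prop

theorem gaussianPDF_le (u : ℝ) (v : ℝ≥0) (x : ℝ) :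
    gaussianPDF u v x ≤ ENNReal.ofReal (√(2 * Real.pi * v))⁻¹ := by
  refine ENNReal.ofReal_le_ofReal ?_
  rw [gaussianPDFReal]
  refine mul_le_of_le_one_right (by positivity) (Real.exp_le_one_iff.2 ?_)
  rw [neg_div, neg_nonpos]
  positivity

theorem gaussianPDF_comm (u : ℝ) (v : ℝ≥0) (x : ℝ) : gaussianPDF u v x = gaussianPDF x v u := by
  rw [gaussianPDF, gaussianPDF, gaussianPDFReal, gaussianPDFReal, sub_sq_comm]

theorem measurable_marginal (π : Measure ℝ) [SFinite π] : Measurable (marginal π) := by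
  refine Measurable.lintegral_prod_right' (f := fun z : ℝ × ℝ => gaussianPDF z.2 1 z.1) ?_
  unfold gaussianPDF gaussianPDFReal
  fun_prop

theorem measurable_jointMarginal (r : ℝ≥0) (π : Measure ℝ) [SFinite π] :
    Measurable (Function.uncurry (jointMarginal r π)) := by
  refine Measurable.lintegral_prod_right'
    (f := fun z : (ℝ × ℝ) × ℝ => gaussianPDF z.2 1 z.1.1 * gaussianPDF z.2 r z.1.2) ?_
  unfold gaussianPDF gaussianPDFReal
  fun_prop

section Prior

variable (π : Measure ℝ) [IsProbabilityMeasure π]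

theorem marginal_ne_zero (x : ℝ) : marginal π x ≠ 0 := by
  rw [marginal, ne_eq, lintegral_eq_zero_iff (measurable_gaussianPDF_mean 1 x)]
  intro h
  obtain ⟨u, hu⟩ := h.exists
  exact (gaussianPDF_pos u one_ne_zero x).ne' hu

theorem marginal_ne_top (x : ℝ) : marginal π x ≠ ∞ := by
  refine ne_top_of_le_ne_top ENNReal.ofReal_ne_top
    ((lintegral_mono fun u => gaussianPDF_le u 1 x).trans_eq (by rw [lintegral_const, measure_univ,
      mul_one]))

theorem jointMarginal_ne_zero {r : ℝ≥0} (hr : r ≠ 0) (x y : ℝ) : jointMarginal r π x y ≠ 0 := by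
  have hm : Measurable fun u => gaussianPDF u 1 x * gaussianPDF u r y :=
    (measurable_gaussianPDF_mean 1 x).mul (measurable_gaussianPDF_mean r y)
  rw [jointMarginal, ne_eq, lintegral_eq_zero_iff hm]
  intro h
  obtain ⟨u, hu⟩ := h.exists
  exact mul_ne_zero (gaussianPDF_pos u one_ne_zero x).ne' (gaussianPDF_pos u hr y).ne' hu

theorem jointMarginal_ne_top (r : ℝ≥0) (x y : ℝ) : jointMarginal r π x y ≠ ∞ := by
  refine ne_top_of_le_ne_top (ENNReal.mul_ne_top ENNReal.ofReal_ne_top ENNReal.ofReal_ne_top)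
    ((lintegral_mono fun u => mul_le_mul' (gaussianPDF_le u 1 x) (gaussianPDF_le u r y)).trans_eq
      (by rw [lintegral_const, measure_univ, mul_one]))

theorem lintegral_marginal : ∫⁻ x, marginal π x = 1 := by
  unfold marginal
  rw [lintegral_lintegral_swap]
  · simp_rw [lintegral_gaussianPDF_eq_one _ one_ne_zero]
    simp
  · refine Measurable.aemeasurable ?_
    unfold Function.uncurry gaussianPDF gaussianPDFReal
    fun_prop

theorem lintegral_jointMarginal {r : ℝ≥0} (hr : r ≠ 0) (x : ℝ) :
    ∫⁻ y, jointMarginal r π x y = marginal π x := by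
  unfold jointMarginal marginal
  rw [lintegral_lintegral_swap]
  · refine lintegral_congr fun u => ?_
    rw [lintegral_const_mul _ (measurable_gaussianPDF _ _), lintegral_gaussianPDF_eq_one _ hr,
      mul_one]
  · refine Measurable.aemeasurable ?_
    unfold Function.uncurry gaussianPDF gaussianPDFReal
    fun_prop

theorem bayesPDE_pi {n : ℕ} (r : ℝ≥0) (x y : Fin n → ℝ) :
    bayesPDE r (Measure.pi fun _ : Fin n => π) x y =
      (∏ i, marginal π (x i))⁻¹ * ∏ i, jointMarginal r π (x i) (y i) := by
  have hm : ∀ (v : ℝ≥0) (z : Fin n → ℝ), Measurable fun θ => gaussianDensity v θ z := fun v z =>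
    Finset.measurable_fun_prod _ fun i _ =>
      (measurable_gaussianPDF_mean v (z i)).comp (measurable_pi_apply i)
  rw [bayesPDE, posteriorLaw, lintegral_smul_measure,
    lintegral_withDensity_eq_lintegral_mul _ (hm 1 x) (hm r y), smul_eq_mul]
  congr 2
  · exact lintegral_pi_prod _ _ fun i => measurable_gaussianPDF_mean 1 (x i)
  · have : ∀ θ : Fin n → ℝ, ((fun θ => gaussianDensity 1 θ x) * fun θ => gaussianDensity r θ y) θ =
        ∏ i, gaussianPDF (θ i) 1 (x i) * gaussianPDF (θ i) r (y i) := fun θ =>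
      Finset.prod_mul_distrib.symm
    simp_rw [this]
    exact lintegral_pi_prod _ (fun i u => gaussianPDF u 1 (x i) * gaussianPDF u r (y i)) fun i =>
      (measurable_gaussianPDF_mean 1 (x i)).mul (measurable_gaussianPDF_mean r (y i))

theorem prod_marginal_ne_zero {n : ℕ} (x : Fin n → ℝ) : ∏ i, marginal π (x i) ≠ 0 :=
  Finset.prod_ne_zero_iff.2 fun _ _ => marginal_ne_zero π _

theorem prod_marginal_ne_top {n : ℕ} (x : Fin n → ℝ) : ∏ i, marginal π (x i) ≠ ∞ :=
  ENNReal.prod_ne_top fun _ _ => marginal_ne_top π _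

theorem isPDE_bayesPDE_pi {n : ℕ} {r : ℝ≥0} (hr : r ≠ 0) :
    IsPDE (bayesPDE r (Measure.pi fun _ : Fin n => π)) := by
  have hJ : ∀ x : ℝ, Measurable (jointMarginal r π x) := fun x =>
    (measurable_jointMarginal r π).of_uncurry_left
  refine ⟨?_, fun x => ?_⟩
  · have : Function.uncurry (bayesPDE r (Measure.pi fun _ : Fin n => π)) = fun z =>
        (∏ i, marginal π (z.1 i))⁻¹ * ∏ i, jointMarginal r π (z.1 i) (z.2 i) := by
      ext z; exact bayesPDE_pi π r z.1 z.2
    rw [this]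
    refine Measurable.mul (Measurable.inv ?_) ?_
    · have hz : ∀ i, Measurable fun z : (Fin n → ℝ) × (Fin n → ℝ) => z.1 i := fun i => by fun_prop
      exact Finset.measurable_fun_prod _ fun i _ => (measurable_marginal π).comp (hz i)
    · refine Finset.measurable_fun_prod _ fun i _ => ?_
      have hz : Measurable fun z : (Fin n → ℝ) × (Fin n → ℝ) => (z.1 i, z.2 i) := by fun_prop
      have h := (measurable_jointMarginal r π).comp hz
      simpa only [Function.comp_def, Function.uncurry_apply_pair] using h
  · simp_rw [bayesPDE_pi]
    have hprod : Measurable fun y : Fin n → ℝ => ∏ i, jointMarginal r π (x i) (y i) :=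
      Finset.measurable_fun_prod _ fun i _ => (hJ (x i)).comp (measurable_pi_apply i)
    rw [lintegral_const_mul _ hprod, volume_pi,
      lintegral_pi_prod _ (fun i => jointMarginal r π (x i)) fun i => hJ (x i)]
    simp_rw [lintegral_jointMarginal π hr]
    exact ENNReal.inv_mul_cancel (prod_marginal_ne_zero π x) (prod_marginal_ne_top π x)

end Prior

/-- Since the exponent is affine in each `y i`, averaging over `Y` only replaces `y i` by its mean
`θ i`, and averaging over `X` leaves a sum of univariate integrals. -/
theorem risk_le_of_dominated {n : ℕ} {r : ℝ≥0} (hr : r ≠ 0) (θ : Fin n → ℝ)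
    {q : (Fin n → ℝ) → (Fin n → ℝ) → ℝ≥0∞} (hq : IsPDE q) (hq0 : ∀ x y, q x y ≠ 0)
    (hqt : ∀ x y, q x y ≠ ∞) (α : Fin n → ℝ → ℝ) (β : Fin n → ℝ)
    (hα : ∀ i, Integrable (α i) (gaussianReal (θ i) 1))
    (hdom : ∀ x y, gaussianDensity r θ y ≤
      ENNReal.ofReal (Real.exp (∑ i, (α i (x i) + β i * y i))) * q x y) :
    risk r θ q ≤
      ENNReal.ofReal (∑ i, (∫ x, α i x ∂(gaussianReal (θ i) 1) + β i * θ i)) := by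
  have := isProbabilityMeasure_gaussianLaw (one_ne_zero (α := ℝ≥0)) θ
  have := isProbabilityMeasure_gaussianLaw hr θ
  have hy : ∀ i, Integrable (fun y : Fin n → ℝ => y i) (gaussianLaw r θ) := by
    intro i
    rw [gaussianLaw_eq_pi hr]
    exact integrable_comp_eval (μ := fun i => gaussianReal (θ i) r)
      (integrable_id_gaussianReal (θ i) r)
  have hyi : ∀ i, ∫ y, y i ∂(gaussianLaw r θ) = θ i := by
    intro i
    rw [gaussianLaw_eq_pi hr, integral_comp_eval (μ := fun i => gaussianReal (θ i) r)
      (f := fun y => y) (integrable_id_gaussianReal (θ i) r).1, integral_id_gaussianReal]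
  have hx : ∀ i, Integrable (fun x : Fin n → ℝ => α i (x i)) (gaussianLaw 1 θ) := by
    intro i
    rw [gaussianLaw_eq_pi one_ne_zero]
    exact integrable_comp_eval (μ := fun i => gaussianReal (θ i) 1) (hα i)
  have hxi : ∀ i, ∫ x, α i (x i) ∂(gaussianLaw 1 θ) = ∫ x, α i x ∂(gaussianReal (θ i) 1) := by
    intro i
    rw [gaussianLaw_eq_pi one_ne_zero,
      integral_comp_eval (μ := fun i => gaussianReal (θ i) 1) (hα i).1]
  have hU : ∀ x : Fin n → ℝ,
      Integrable (fun y : Fin n → ℝ => ∑ i, (α i (x i) + β i * y i)) (gaussianLaw r θ) :=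
    fun x => integrable_finsetSum _ fun i _ => (integrable_const _).add ((hy i).const_mul _)
  have hV : ∀ x : Fin n → ℝ, ∫ y, ∑ i, (α i (x i) + β i * y i) ∂(gaussianLaw r θ) =
      ∑ i, (α i (x i) + β i * θ i) := by
    intro x
    have hi : ∀ i, Integrable (fun y : Fin n → ℝ => α i (x i) + β i * y i) (gaussianLaw r θ) :=
      fun i => (integrable_const _).add ((hy i).const_mul _)
    rw [integral_finsetSum _ fun i _ => hi i]
    refine Finset.sum_congr rfl fun i _ => ?_
    rw [integral_add (integrable_const _) ((hy i).const_mul _), integral_const_mul, hyi]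
    simp
  have hkl : ∀ x, klLoss r θ (q x) ≤ ENNReal.ofReal (∑ i, (α i (x i) + β i * θ i)) ∧
      0 ≤ ∑ i, (α i (x i) + β i * θ i) := by
    intro x
    have := isProbabilityMeasure_withDensity_of_isPDE hq x
    have hqx : Measurable (q x) := hq.measurable.of_uncurry_left
    have hF : Measurable fun y => gaussianDensity r θ y / q x y :=
      (measurable_gaussianDensity r θ).div hqx
    have hμ : gaussianLaw r θ =
        (volume.withDensity (q x)).withDensity fun y => gaussianDensity r θ y / q x y := by
      rw [← withDensity_mul _ hqx hF, gaussianLaw]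
      congr 1
      ext y
      exact (ENNReal.mul_div_cancel (hq0 x y) (hqt x y)).symm
    have := klDiv_le_of_density_le_exp hF hμ
      (fun y => ENNReal.div_le_of_le_mul (hdom x y)) (hU x)
    rwa [hV x] at this
  have hαi : ∀ i, Integrable (fun x : Fin n → ℝ => α i (x i) + β i * θ i) (gaussianLaw 1 θ) :=
    fun i => (hx i).add (integrable_const _)
  calc risk r θ q ≤ ∫⁻ x, ENNReal.ofReal (∑ i, (α i (x i) + β i * θ i)) ∂(gaussianLaw 1 θ) :=
        lintegral_mono fun x => (hkl x).1
    _ = ENNReal.ofReal (∫ x, ∑ i, (α i (x i) + β i * θ i) ∂(gaussianLaw 1 θ)) :=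
        (ofReal_integral_eq_lintegral_ofReal (integrable_finsetSum _ fun i _ => hαi i)
          (ae_of_all _ fun x => (hkl x).2)).symm
    _ = _ := by
        rw [integral_finsetSum _ fun i _ => hαi i]
        congr 1
        refine Finset.sum_congr rfl fun i _ => ?_
        rw [integral_add (hx i) (integrable_const _), hxi]
        simp

/-- The log likelihood ratio at `θ` of the predictive density for the prior `π` is at most
`α x + β y`, where `α` is integrable under `N(θ, 1)`. -/
structure Dominates (π : Measure ℝ) (r : ℝ≥0) (θ : ℝ) (α : ℝ → ℝ) (β : ℝ) : Prop where
  integrable : Integrable α (gaussianReal θ 1)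
  le : ∀ x y, gaussianPDF θ r y * marginal π x ≤
    ENNReal.ofReal (Real.exp (α x + β * y)) * jointMarginal r π x y

theorem risk_bayesPDE_pi_le (π : Measure ℝ) [IsProbabilityMeasure π] {n : ℕ} {r : ℝ≥0}
    (hr : r ≠ 0) (θ : Fin n → ℝ) (α : Fin n → ℝ → ℝ) (β : Fin n → ℝ)
    (h : ∀ i, Dominates π r (θ i) (α i) (β i)) :
    risk r θ (bayesPDE r (Measure.pi fun _ : Fin n => π)) ≤
      ENNReal.ofReal (∑ i, (∫ x, α i x ∂(gaussianReal (θ i) 1) + β i * θ i)) := by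
  have hJ0 : ∀ x y : Fin n → ℝ, ∏ i, jointMarginal r π (x i) (y i) ≠ 0 := fun x y =>
    Finset.prod_ne_zero_iff.2 fun _ _ => jointMarginal_ne_zero π hr _ _
  have hJt : ∀ x y : Fin n → ℝ, ∏ i, jointMarginal r π (x i) (y i) ≠ ∞ := fun x y =>
    ENNReal.prod_ne_top fun _ _ => jointMarginal_ne_top π r _ _
  refine risk_le_of_dominated hr θ (isPDE_bayesPDE_pi π hr) (fun x y => ?_) (fun x y => ?_) α β
    (fun i => (h i).integrable) fun x y => ?_
  · rw [bayesPDE_pi]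
    exact mul_ne_zero (ENNReal.inv_ne_zero.2 (prod_marginal_ne_top π x)) (hJ0 x y)
  · rw [bayesPDE_pi]
    exact ENNReal.mul_ne_top (ENNReal.inv_ne_top.2 (prod_marginal_ne_zero π x)) (hJt x y)
  · have h1 := Finset.prod_le_prod' fun i (_ : i ∈ Finset.univ) => (h i).le (x i) (y i)
    rw [Finset.prod_mul_distrib, Finset.prod_mul_distrib,
      ← ENNReal.ofReal_prod_of_nonneg fun i _ => (Real.exp_pos _).le, ← Real.exp_sum] at h1
    rw [bayesPDE_pi, mul_left_comm, ← ENNReal.div_eq_inv_mul]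
    exact (ENNReal.le_div_iff_mul_le (Or.inl (prod_marginal_ne_zero π x))
      (Or.inl (prod_marginal_ne_top π x))).2 h1

/-! ### The spike and slab prior -/

theorem lintegral_spikeSlab (η l : ℝ) {f : ℝ → ℝ≥0∞} (hf : Measurable f) :
    ∫⁻ u, f u ∂(spikeSlab η l) = ENNReal.ofReal (1 - η) * f 0 +
      ENNReal.ofReal (η / (2 * l)) * ∫⁻ u in Set.Icc (-l) l, f u := by
  rw [spikeSlab, lintegral_add_measure, lintegral_smul_measure, lintegral_smul_measure,
    lintegral_dirac' _ hf, smul_eq_mul, smul_eq_mul]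

theorem isProbabilityMeasure_spikeSlab {η l : ℝ} (h0 : 0 ≤ η) (h1 : η ≤ 1) (hl : 0 < l) :
    IsProbabilityMeasure (spikeSlab η l) := by
  refine ⟨?_⟩
  rw [← lintegral_one, lintegral_spikeSlab η l measurable_const, setLIntegral_one, Real.volume_Icc,
    ← ENNReal.ofReal_mul (by positivity), mul_one, ← ENNReal.ofReal_add (by linarith)
    (mul_nonneg (by positivity) (by linarith)), ← ENNReal.ofReal_one]
  congr 1
  field_simp
  ring

section Bounds

variable {η l : ℝ}

/-- The slab contributes at most `η / (2l)`, and `2l ≥ √(2π)`; relative to the standard normal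
density, `η / √(2π)` is `η exp (x² / 2)`. -/
theorem marginal_spikeSlab_le (h0 : 0 ≤ η) (h1 : η ≤ 1) (hl : 2 ≤ l) (x : ℝ) :
    marginal (spikeSlab η l) x ≤
      gaussianPDF 0 1 x * ENNReal.ofReal (1 + η * Real.exp (x ^ 2 / 2)) := by
  have hpi : √(2 * Real.pi) ≤ 2 * l := by
    rw [Real.sqrt_le_left (by linarith)]
    nlinarith [Real.pi_le_four]
  have hs0 : 0 < √(2 * Real.pi) := Real.sqrt_pos.2 (by positivity)
  have hφ : gaussianPDFReal 0 1 x = (√(2 * Real.pi))⁻¹ * (Real.exp (x ^ 2 / 2))⁻¹ := by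
    rw [gaussianPDFReal, ← Real.exp_neg]
    simp [neg_div]
  rw [marginal, lintegral_spikeSlab _ _ (measurable_gaussianPDF_mean 1 x)]
  have hint : ∫⁻ u in Set.Icc (-l) l, gaussianPDF u 1 x ≤ 1 := by
    refine (setLIntegral_le_lintegral _ _).trans_eq ?_
    simp_rw [fun u => gaussianPDF_comm u 1 x]
    exact lintegral_gaussianPDF_eq_one x one_ne_zero
  calc _ ≤ ENNReal.ofReal (1 - η) * gaussianPDF 0 1 x + ENNReal.ofReal (η / (2 * l)) * 1 := by
        gcongr
    _ = ENNReal.ofReal ((1 - η) * gaussianPDFReal 0 1 x + η / (2 * l)) := by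
        rw [mul_one, gaussianPDF, ← ENNReal.ofReal_mul (by linarith), ← ENNReal.ofReal_add
          (mul_nonneg (by linarith) (gaussianPDFReal_nonneg _ _ _)) (by positivity)]
    _ ≤ ENNReal.ofReal (gaussianPDFReal 0 1 x * (1 + η * Real.exp (x ^ 2 / 2))) := by
        refine ENNReal.ofReal_le_ofReal ?_
        have e1 : gaussianPDFReal 0 1 x * (η * Real.exp (x ^ 2 / 2)) = η / √(2 * Real.pi) := by
          rw [hφ]; field_simp
        have e2 : η / (2 * l) ≤ η / √(2 * Real.pi) := by gcongr
        have e3 : (1 - η) * gaussianPDFReal 0 1 x ≤ gaussianPDFReal 0 1 x := by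
          nlinarith [gaussianPDFReal_nonneg 0 1 x]
        rw [mul_add, mul_one, e1]
        linarith
    _ = _ := by rw [ENNReal.ofReal_mul (gaussianPDFReal_nonneg _ _ _), gaussianPDF]

theorem one_add_mul_exp_le {c : ℝ} (hη : η ≤ Real.exp (-(c ^ 2 / 2))) (x : ℝ) :
    1 + η * Real.exp (x ^ 2 / 2) ≤
      Real.exp (Real.log 2 + (max (x ^ 2) (c ^ 2) - c ^ 2) / 2) := by
  rw [Real.exp_add, Real.exp_log two_pos, two_mul]
  refine add_le_add (Real.one_le_exp ?_) ?_
  · have := le_max_right (x ^ 2) (c ^ 2)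
    linarith
  · calc η * Real.exp (x ^ 2 / 2) ≤ Real.exp (-(c ^ 2 / 2)) * Real.exp (x ^ 2 / 2) := by gcongr
      _ = Real.exp ((x ^ 2 - c ^ 2) / 2) := by rw [← Real.exp_add]; ring_nf
      _ ≤ _ := by gcongr; exact le_max_left _ _

/-- The coefficient of the linear term in `max_sq_le`. -/
noncomputable def linCoeff (c θ : ℝ) : ℝ := if c ^ 2 ≤ θ ^ 2 then θ else 0

/-- A first-order expansion at `θ` of half the positive part of `x² - c²`, where `c |x - θ|` absorbs
the kink. The linear term has mean zero under `N(θ, 1)`, so the error in mean is of order `c`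
however large `θ` is. -/
theorem max_sq_le {c : ℝ} (hc : 0 ≤ c) (θ x : ℝ) :
    (max (x ^ 2) (c ^ 2) - c ^ 2) / 2 ≤ (max (θ ^ 2) (c ^ 2) - c ^ 2) / 2 + c * |x - θ| +
      (x - θ) ^ 2 / 2 + linCoeff c θ * (x - θ) := by
  have hg : 0 ≤ c * |x - θ| := by positivity
  have ht : |θ| ≤ |x| + |x - θ| := by
    have := abs_sub_abs_le_abs_sub θ x
    rw [abs_sub_comm θ x] at this
    linarith
  have ht' : |x| ≤ |θ| + |x - θ| := by
    have := abs_sub_abs_le_abs_sub x θ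
    linarith
  unfold linCoeff
  split_ifs with h
  · rw [max_eq_left h]
    have hcθ : c ≤ |θ| := by rwa [← sq_abs θ, sq_le_sq₀ hc (abs_nonneg θ)] at h
    rcases le_total (x ^ 2) (c ^ 2) with hx | hx
    · rw [max_eq_right hx]
      have hxc : |x| ≤ c := by rwa [← sq_abs x, sq_le_sq₀ (abs_nonneg x) hc] at hx
      nlinarith [sq_abs x, abs_nonneg x, abs_nonneg (x - θ)]
    · rw [max_eq_left hx]
      nlinarith
  · rw [max_eq_right (not_le.1 h).le]
    have hcθ : |θ| ≤ c := by
      have := (not_le.1 h).le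
      rwa [← sq_abs θ, sq_le_sq₀ (abs_nonneg θ) hc] at this
    rcases le_total (x ^ 2) (c ^ 2) with hx | hx
    · rw [max_eq_right hx]
      nlinarith [sq_nonneg (x - θ)]
    · rw [max_eq_left hx]
      nlinarith [sq_abs x, sq_abs (x - θ), abs_nonneg x, abs_nonneg (x - θ)]

/-- An upper bound for the log marginal likelihood ratio, centred at `θ`. -/
noncomputable def marginalBound (c θ x : ℝ) : ℝ :=
  Real.log 2 + ((max (θ ^ 2) (c ^ 2) - c ^ 2) / 2 + c * |x - θ| +
      (x - θ) ^ 2 / 2 + linCoeff c θ * (x - θ))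

theorem marginal_spikeSlab_le_exp_marginalBound (h0 : 0 ≤ η) (h1 : η ≤ 1) (hl : 2 ≤ l) {c : ℝ}
    (hc : 0 ≤ c) (hη : η ≤ Real.exp (-(c ^ 2 / 2))) (θ x : ℝ) :
    marginal (spikeSlab η l) x ≤
      gaussianPDF 0 1 x * ENNReal.ofReal (Real.exp (marginalBound c θ x)) := by
  refine (marginal_spikeSlab_le h0 h1 hl x).trans ?_
  gcongr
  refine (one_add_mul_exp_le hη x).trans (Real.exp_le_exp.2 ?_)
  exact add_le_add le_rfl (max_sq_le hc θ x)

theorem integrable_marginalBound (c θ : ℝ) :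
    Integrable (marginalBound c θ) (gaussianReal θ 1) :=
  (integrable_const _).add ((((integrable_const _).add
    ((integrable_abs_sub_gaussianReal θ 1).const_mul c)).add
    ((integrable_sq_sub_gaussianReal θ 1).div_const 2)).add
    (((integrable_id_gaussianReal θ 1).sub (integrable_const θ)).const_mul _))

theorem integral_marginalBound_le {c : ℝ} (hc : 0 ≤ c) (θ : ℝ) :
    ∫ x, marginalBound c θ x ∂(gaussianReal θ 1) ≤
      Real.log 2 + (max (θ ^ 2) (c ^ 2) - c ^ 2) / 2 + c + 1 / 2 := by
  have i1 := (integrable_abs_sub_gaussianReal θ 1).const_mul c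
  have i2 := (integrable_sq_sub_gaussianReal θ 1).div_const 2
  have i3 : Integrable (fun x => x - θ) (gaussianReal θ 1) :=
    (integrable_id_gaussianReal θ 1).sub (integrable_const θ)
  have e3 : ∫ x, (x - θ) ∂(gaussianReal θ 1) = 0 := by
    rw [integral_sub (integrable_id_gaussianReal θ 1) (integrable_const θ),
      integral_id_gaussianReal]
    simp
  have e1 : ∫ x, |x - θ| ∂(gaussianReal θ 1) ≤ 1 := by
    simpa using integral_abs_sub_gaussianReal_le θ 1
  have e : ∫ x, marginalBound c θ x ∂(gaussianReal θ 1) =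
      Real.log 2 + (max (θ ^ 2) (c ^ 2) - c ^ 2) / 2 +
        c * ∫ x, |x - θ| ∂(gaussianReal θ 1) + 1 / 2 := by
    have hre : marginalBound c θ = fun x => (Real.log 2 + (max (θ ^ 2) (c ^ 2) - c ^ 2) / 2) +
        (c * |x - θ| + ((x - θ) ^ 2 / 2 + linCoeff c θ * (x - θ))) := by
      ext x; unfold marginalBound; ring
    have i4 : Integrable (fun x => (x - θ) ^ 2 / 2 + linCoeff c θ * (x - θ)) (gaussianReal θ 1) :=
      i2.add (i3.const_mul _)
    have i5 : Integrable (fun x => c * |x - θ| + ((x - θ) ^ 2 / 2 + linCoeff c θ * (x - θ)))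
      (gaussianReal θ 1) := i1.add i4
    rw [hre, integral_add (integrable_const _) i5, integral_add i1 i4,
      integral_add i2 (i3.const_mul _), integral_const_mul, integral_const_mul, integral_div,
      integral_sq_sub_gaussianReal, e3]
    simp
    ring
  rw [e]
  nlinarith

/-! ### Lower bounds for the joint marginal. -/

theorem spike_le_jointMarginal (r : ℝ≥0) (x y : ℝ) :
    ENNReal.ofReal (1 - η) * (gaussianPDF 0 1 x * gaussianPDF 0 r y) ≤
      jointMarginal r (spikeSlab η l) x y := by
  have hm : Measurable fun u => gaussianPDF u 1 x * gaussianPDF u r y :=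
    (measurable_gaussianPDF_mean 1 x).mul (measurable_gaussianPDF_mean r y)
  rw [jointMarginal, lintegral_spikeSlab _ _ hm]
  exact le_self_add

/-- Jensen's inequality for the uniform law on `[b, b + 1]`, by the tangent line of `exp` at the
mean exponent: `u` has mean `b + 1/2` and variance `1/12`. -/
theorem exp_le_lintegral_exp_quadratic (A B b : ℝ) :
    ENNReal.ofReal (Real.exp (A * (b + 1 / 2) - B * ((b + 1 / 2) ^ 2 + 1 / 12))) ≤
      ∫⁻ u in Set.Icc b (b + 1), ENNReal.ofReal (Real.exp (A * u - B * u ^ 2)) := by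
  set w := A * (b + 1 / 2) - B * ((b + 1 / 2) ^ 2 + 1 / 12) with hw
  have hcont : Continuous fun u : ℝ => Real.exp w * (1 + (A * u - B * u ^ 2 - w)) := by fun_prop
  have hint : IntegrableOn (fun u : ℝ => Real.exp w * (1 + (A * u - B * u ^ 2 - w)))
      (Set.Icc b (b + 1)) := hcont.integrableOn_Icc
  have hval : ∫ u in Set.Icc b (b + 1), Real.exp w * (1 + (A * u - B * u ^ 2 - w)) =
      Real.exp w := by
    rw [integral_Icc_eq_integral_Ioc, ← intervalIntegral.integral_of_le (by linarith),
      intervalIntegral.integral_const_mul]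
    have e : ∫ u in b..(b + 1), (1 + (A * u - B * u ^ 2 - w)) = 1 := by
      have : ∀ u : ℝ, 1 + (A * u - B * u ^ 2 - w) = (1 - w) + A * u - B * u ^ 2 := fun u => by ring
      simp_rw [this]
      rw [intervalIntegral.integral_sub (by apply Continuous.intervalIntegrable; fun_prop)
        (by apply Continuous.intervalIntegrable; fun_prop),
        intervalIntegral.integral_add (by apply Continuous.intervalIntegrable; fun_prop)
        (by apply Continuous.intervalIntegrable; fun_prop),
        intervalIntegral.integral_const_mul, intervalIntegral.integral_const_mul,
        integral_id, integral_pow, intervalIntegral.integral_const, hw]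
      simp only [smul_eq_mul]
      push_cast
      ring
    rw [e, mul_one]
  rw [← hval]
  refine (ofReal_integral_le_lintegral hint).trans (lintegral_mono fun u => ?_)
  refine ENNReal.ofReal_le_ofReal ?_
  have h := Real.add_one_le_exp (A * u - B * u ^ 2 - w)
  calc Real.exp w * (1 + (A * u - B * u ^ 2 - w))
      ≤ Real.exp w * Real.exp (A * u - B * u ^ 2 - w) := by
        gcongr; linarith
    _ = _ := by rw [← Real.exp_add]; ring_nf

theorem slab_le_jointMarginal (r : ℝ≥0) {b : ℝ} (hb : -l ≤ b) (hb' : b + 1 ≤ l) (x y : ℝ) :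
    ENNReal.ofReal (η / (2 * l)) * (gaussianPDF 0 1 x * gaussianPDF 0 r y *
      ENNReal.ofReal (Real.exp ((x + y / r) * (b + 1 / 2) -
        (1 + 1 / r) / 2 * ((b + 1 / 2) ^ 2 + 1 / 12)))) ≤
      jointMarginal r (spikeSlab η l) x y := by
  have hm : Measurable fun u => gaussianPDF u 1 x * gaussianPDF u r y :=
    (measurable_gaussianPDF_mean 1 x).mul (measurable_gaussianPDF_mean r y)
  rw [jointMarginal, lintegral_spikeSlab _ _ hm]
  refine le_trans ?_ le_add_self
  gcongr
  have hpt : ∀ u, gaussianPDF u 1 x * gaussianPDF u r y = gaussianPDF 0 1 x * gaussianPDF 0 r y *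
      ENNReal.ofReal (Real.exp ((x + y / r) * u - (1 + 1 / r) / 2 * u ^ 2)) := by
    intro u
    rw [gaussianPDF_eq_mul_likRatio 1 u x, gaussianPDF_eq_mul_likRatio r u y, mul_mul_mul_comm,
      ← ENNReal.ofReal_mul (likRatio_pos _ _ _).le, likRatio, likRatio, ← Real.exp_add]
    congr 3
    rw [NNReal.coe_one, ← div_div (u ^ 2) 2 (r : ℝ)]
    ring
  rw [lintegral_congr hpt]
  rw [lintegral_const_mul _ (by fun_prop)]
  gcongr
  refine (exp_le_lintegral_exp_quadratic _ _ b).trans ?_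
  exact lintegral_mono_set (Set.Icc_subset_Icc hb hb')

/-- Keep only the spike in the joint marginal. The remaining marginal ratio `D` has mean 1 under
`N(0, 1)`, and `log D ≤ D - 1` has a bound of mean zero, leaving only `-log (1 - η)`. -/
theorem exists_dominates_zero {r : ℝ≥0} (h0 : 0 ≤ η) (h1 : η < 1) (hl : 0 < l) :
    ∃ α β, Dominates (spikeSlab η l) r 0 α β ∧
      ∫ x, α x ∂(gaussianReal 0 1) + β * 0 ≤ -Real.log (1 - η) := by
  have := isProbabilityMeasure_spikeSlab h0 h1.le hl
  set D : ℝ → ℝ≥0∞ := fun x => marginal (spikeSlab η l) x / gaussianPDF 0 1 x with hD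
  have hφ0 : ∀ x, gaussianPDF 0 1 x ≠ 0 := fun x => (gaussianPDF_pos 0 one_ne_zero x).ne'
  have hDm : Measurable D := (measurable_marginal _).div (measurable_gaussianPDF 0 1)
  have hDt : ∀ x, D x ≠ ∞ := fun x => ENNReal.div_ne_top (marginal_ne_top _ x) (hφ0 x)
  have hDφ : ∀ x, gaussianPDF 0 1 x * D x = marginal (spikeSlab η l) x := fun x =>
    ENNReal.mul_div_cancel (hφ0 x) gaussianPDF_ne_top
  have hD1 : ∫⁻ x, D x ∂(gaussianReal 0 1) = 1 := by
    rw [gaussianReal_of_var_ne_zero _ one_ne_zero,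
      lintegral_withDensity_eq_lintegral_mul _ (measurable_gaussianPDF 0 1) hDm,
      ← lintegral_marginal (spikeSlab η l)]
    exact lintegral_congr hDφ
  have hDi : Integrable (fun x => (D x).toReal) (gaussianReal 0 1) :=
    integrable_toReal_of_lintegral_ne_top hDm.aemeasurable (by rw [hD1]; simp)
  have hDr : ∫ x, (D x).toReal ∂(gaussianReal 0 1) = 1 := by
    rw [integral_toReal hDm.aemeasurable (ae_of_all _ fun x => (hDt x).lt_top), hD1]; simp
  refine ⟨fun x => (D x).toReal - (1 + Real.log (1 - η)), 0,
    ⟨hDi.sub (integrable_const _), fun x y => ?_⟩, ?_⟩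
  · have h2 : D x ≤ ENNReal.ofReal (Real.exp ((D x).toReal - 1)) := by
      rw [← ENNReal.ofReal_toReal (hDt x), ENNReal.toReal_ofReal ENNReal.toReal_nonneg]
      refine ENNReal.ofReal_le_ofReal ?_
      have := Real.add_one_le_exp ((D x).toReal - 1)
      linarith
    have h3 : ENNReal.ofReal (Real.exp ((D x).toReal - (1 + Real.log (1 - η)) + 0 * y)) *
        ENNReal.ofReal (1 - η) = ENNReal.ofReal (Real.exp ((D x).toReal - 1)) := by
      rw [← ENNReal.ofReal_mul (Real.exp_pos _).le]
      congr 1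
      nth_rewrite 2 [← Real.exp_log (show 0 < 1 - η by linarith)]
      rw [← Real.exp_add]
      ring_nf
    calc gaussianPDF 0 r y * marginal (spikeSlab η l) x
        = D x * (gaussianPDF 0 1 x * gaussianPDF 0 r y) := by rw [← hDφ]; ring
      _ ≤ ENNReal.ofReal (Real.exp ((D x).toReal - 1)) *
          (gaussianPDF 0 1 x * gaussianPDF 0 r y) := by gcongr
      _ = ENNReal.ofReal (Real.exp ((D x).toReal - (1 + Real.log (1 - η)) + 0 * y)) *
          (ENNReal.ofReal (1 - η) * (gaussianPDF 0 1 x * gaussianPDF 0 r y)) := by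
        rw [← h3, mul_assoc]
      _ ≤ _ := by gcongr; exact spike_le_jointMarginal r x y
  · rw [integral_sub hDi (integrable_const _), hDr]
    simp

/-- If the joint marginal is at least `e^{-κ}` times the joint likelihood ratio
`exp (p x + q y)`, the marginal bound yields a dominating pair. -/
theorem dominates_of_le_jointMarginal {r : ℝ≥0} (h0 : 0 ≤ η) (h1 : η ≤ 1) (hl : 2 ≤ l)
    {c : ℝ} (hc : 0 ≤ c) (hη : η ≤ Real.exp (-(c ^ 2 / 2))) (θ κ p q : ℝ)
    (h : ∀ x y, gaussianPDF 0 1 x * gaussianPDF 0 r y *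
      ENNReal.ofReal (Real.exp (p * x + q * y - κ)) ≤ jointMarginal r (spikeSlab η l) x y) :
    Dominates (spikeSlab η l) r θ
      (fun x => marginalBound c θ x + (κ - θ ^ 2 / (2 * r)) - p * x) (θ / r - q) := by
  refine ⟨((integrable_marginalBound c θ).add (integrable_const _)).sub
    ((integrable_id_gaussianReal θ 1).const_mul p), fun x y => ?_⟩
  set E := Real.exp (marginalBound c θ x + (κ - θ ^ 2 / (2 * r)) - p * x + (θ / r - q) * y)
  have e : ENNReal.ofReal (likRatio r θ y) * ENNReal.ofReal (Real.exp (marginalBound c θ x)) =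
      ENNReal.ofReal E * ENNReal.ofReal (Real.exp (p * x + q * y - κ)) := by
    rw [← ENNReal.ofReal_mul (likRatio_pos _ _ _).le, ← ENNReal.ofReal_mul (Real.exp_pos _).le,
      likRatio, ← Real.exp_add, ← Real.exp_add]
    congr 2
    ring
  calc gaussianPDF θ r y * marginal (spikeSlab η l) x
      ≤ gaussianPDF 0 r y * ENNReal.ofReal (likRatio r θ y) *
        (gaussianPDF 0 1 x * ENNReal.ofReal (Real.exp (marginalBound c θ x))) := by
        rw [← gaussianPDF_eq_mul_likRatio]
        gcongr
        exact marginal_spikeSlab_le_exp_marginalBound h0 h1 hl hc hη θ x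
    _ = (gaussianPDF 0 1 x * gaussianPDF 0 r y) * (ENNReal.ofReal (likRatio r θ y) *
        ENNReal.ofReal (Real.exp (marginalBound c θ x))) := by ring
    _ = ENNReal.ofReal E * (gaussianPDF 0 1 x * gaussianPDF 0 r y *
        ENNReal.ofReal (Real.exp (p * x + q * y - κ))) := by rw [e]; ring
    _ ≤ _ := by gcongr; exact h x y

/-- The bound for the univariate predictive risk of the spike and slab prior. -/
noncomputable def riskBound (r : ℝ≥0) (c l : ℝ) : ℝ :=
  c ^ 2 / (2 * (1 + r)) + c + 1 / 2 + 2 * Real.log 2 + Real.log (2 * l) + (1 + 1 / r) / 6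

/-- To leading order the spike costs `θ² / (2r)`, and the slab costs half the positive part of `c² -
θ²`, plus `log (2l)`. For `θ² = r / (1 + r) c²` the two main terms both equal `c² / (2 (1 + r))`,
which is where the cases divide. -/
theorem exists_dominates {r : ℝ≥0} (hr : 0 < r) (h0 : 0 < η) (h1 : η ≤ 1 / 2) (hl : 2 ≤ l)
    {c : ℝ} (hc : 0 ≤ c) (hη : η = Real.exp (-(c ^ 2 / 2))) {θ : ℝ} (hθ : |θ| ≤ l) :
    ∃ α β, Dominates (spikeSlab η l) r θ α β ∧
      ∫ x, α x ∂(gaussianReal θ 1) + β * θ ≤ riskBound r c l := by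
  have hr' : (0 : ℝ) < r := hr
  have hlog2 : 0 < Real.log 2 := Real.log_pos one_lt_two
  have hlogl : 0 ≤ Real.log (2 * l) := Real.log_nonneg (by linarith)
  have hval : ∀ κ p q : ℝ, ∫ x, (marginalBound c θ x + (κ - θ ^ 2 / (2 * r)) - p * x)
      ∂(gaussianReal θ 1) + (θ / r - q) * θ ≤
      Real.log 2 + (max (θ ^ 2) (c ^ 2) - c ^ 2) / 2 + c + 1 / 2 + κ + θ ^ 2 / (2 * r) -
        (p + q) * θ := by
    intro κ p q
    have i1 := integrable_marginalBound c θ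
    have i2 : Integrable (fun x => marginalBound c θ x + (κ - θ ^ 2 / (2 * r)))
      (gaussianReal θ 1) := i1.add (integrable_const _)
    rw [integral_sub i2 ((integrable_id_gaussianReal θ 1).const_mul p),
      integral_add i1 (integrable_const _), integral_const_mul, integral_id_gaussianReal]
    have h2 := integral_marginalBound_le hc θ
    have e : (θ / r - q) * θ = 2 * (θ ^ 2 / (2 * r)) - q * θ := by field_simp
    rw [e]
    simp only [integral_const, probReal_univ, smul_eq_mul, one_mul]
    linarith
  rcases le_total (θ ^ 2) (r / (1 + r) * c ^ 2) with hcase | hcase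
  · have hd : ∀ x y, gaussianPDF 0 1 x * gaussianPDF 0 r y *
        ENNReal.ofReal (Real.exp (0 * x + 0 * y - Real.log 2)) ≤
        jointMarginal r (spikeSlab η l) x y := by
      intro x y
      refine le_trans ?_ (spike_le_jointMarginal (η := η) r x y)
      rw [mul_comm]
      gcongr
      rw [zero_mul, zero_mul, zero_add, zero_sub, Real.exp_neg, Real.exp_log two_pos]
      linarith
    refine ⟨_, _, dominates_of_le_jointMarginal h0.le (by linarith) hl hc hη.le θ _ _ _ hd,
      (hval _ _ _).trans ?_⟩
    have hle : r / (1 + r) * c ^ 2 ≤ c ^ 2 :=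
      mul_le_of_le_one_left (sq_nonneg c) ((div_le_one (by positivity)).2 (by linarith))
    have h3 : θ ^ 2 / (2 * r) ≤ c ^ 2 / (2 * (1 + r)) := by
      rw [div_le_iff₀ (by positivity)]
      refine hcase.trans_eq ?_
      field_simp
    rw [max_eq_right (hcase.trans hle), riskBound]
    have : 0 ≤ (1 + 1 / (r : ℝ)) / 6 := by positivity
    linarith
  -- A unit interval with endpoint `θ`, extending towards zero, stays inside the slab; its midpoint
  -- is at distance 1/2 from `θ`.
  · obtain ⟨b, hb, hb', hbθ⟩ : ∃ b, -l ≤ b ∧ b + 1 ≤ l ∧ (b + 1 / 2 - θ) ^ 2 = 1 / 4 := by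
      obtain ⟨h3, h4⟩ := abs_le.1 hθ
      rcases le_total 0 θ with h | h
      · exact ⟨θ - 1, by linarith, by linarith, by ring⟩
      · exact ⟨θ, by linarith, by linarith, by ring⟩
    set m := b + 1 / 2 with hm
    set κ := c ^ 2 / 2 + Real.log (2 * l) + (1 + 1 / r) / 2 * (m ^ 2 + 1 / 12) with hκ
    have hd : ∀ x y, gaussianPDF 0 1 x * gaussianPDF 0 r y *
        ENNReal.ofReal (Real.exp (m * x + m / r * y - κ)) ≤
        jointMarginal r (spikeSlab η l) x y := by
      intro x y
      refine le_trans (le_of_eq ?_) (slab_le_jointMarginal (η := η) r hb hb' x y)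
      rw [mul_left_comm, ← ENNReal.ofReal_mul (by positivity)]
      congr 2
      rw [← hm]
      have e1 : η / (2 * l) = Real.exp (-(c ^ 2 / 2) - Real.log (2 * l)) := by
        rw [Real.exp_sub, Real.exp_log (by linarith), hη]
      rw [e1, ← Real.exp_add, hκ]
      congr 1
      ring
    refine ⟨_, _, dominates_of_le_jointMarginal h0.le (by linarith) hl hc hη.le θ _ _ _ hd,
      (hval _ _ _).trans ?_⟩
    -- Polarization of `2 m θ` cancels the `m²` in `κ`; the leftover `1/4 + 1/12` gives the term `(1
    -- + 1 / r) / 6` of `riskBound`.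
    have e2 : (m + m / r) * θ = (1 + 1 / r) / 2 * (m ^ 2 + θ ^ 2 - 1 / 4) := by
      rw [← hbθ]; ring
    have e3 : θ ^ 2 / (2 * r) = (1 + 1 / r) / 2 * θ ^ 2 - θ ^ 2 / 2 := by ring
    have h5 : (max (θ ^ 2) (c ^ 2) - θ ^ 2) / 2 ≤ c ^ 2 / (2 * (1 + r)) := by
      have hnn : 0 ≤ c ^ 2 / (2 * (1 + r)) := by positivity
      rcases le_total (θ ^ 2) (c ^ 2) with h | h
      · rw [max_eq_right h]
        have e4 : r / (1 + r) * c ^ 2 = c ^ 2 - 2 * (c ^ 2 / (2 * (1 + r))) := by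
          field_simp; ring
        linarith
      · rw [max_eq_left h]
        linarith
    rw [e2, e3, riskBound, hκ]
    linarith

/-- The maximal risk of the spike and slab predictive density over the bounded sparse set. -/
theorem maxRisk_spikeSlabPDE_le {r : ℝ≥0} (hr : 0 < r) {n k : ℕ} {s : ℝ} (h0 : 0 < η)
    (h1 : η ≤ 1 / 2) (hl : 2 ≤ l) {c : ℝ} (hc : 0 ≤ c) (hη : η = Real.exp (-(c ^ 2 / 2)))
    (hs : s < k + 1) (hnη : n * η ≤ 2 * k) :
    maxRisk r (sparseSet n s l) (spikeSlabPDE n r η l) ≤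
      ENNReal.ofReal (k * (riskBound r c l + 4)) := by
  have := isProbabilityMeasure_spikeSlab h0.le (by linarith) (show 0 < l by linarith)
  have hr' : (0 : ℝ) < r := hr
  have hlog2 : 0 < Real.log 2 := Real.log_pos one_lt_two
  have hlogl : 0 ≤ Real.log (2 * l) := Real.log_nonneg (by linarith)
  have hM : 0 ≤ riskBound r c l := by unfold riskBound; positivity
  have hlogη : -Real.log (1 - η) ≤ 2 * η := by
    have h2 := Real.one_sub_inv_le_log_of_pos (show 0 < 1 - η by linarith)
    have h3 : (1 - η)⁻¹ ≤ 1 + 2 * η := by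
      rw [inv_le_iff_one_le_mul₀ (by linarith)]
      nlinarith
    linarith
  refine iSup₂_le fun θ hθ => ?_
  have hex : ∀ i, ∃ α β, Dominates (spikeSlab η l) r (θ i) α β ∧
      ∫ x, α x ∂(gaussianReal (θ i) 1) + β * θ i ≤
        2 * η + if θ i ≠ 0 then riskBound r c l else 0 := by
    intro i
    by_cases hi : θ i = 0
    · obtain ⟨α, β, h2, h3⟩ := exists_dominates_zero (r := r) h0.le
        (show η < 1 by linarith) (show 0 < l by linarith)
      rw [hi]
      exact ⟨α, β, h2, by simpa using h3.trans hlogη⟩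
    · obtain ⟨α, β, h2, h3⟩ := exists_dominates hr h0 h1 hl hc hη (hθ.2 i)
      refine ⟨α, β, h2, h3.trans ?_⟩
      rw [if_pos hi]
      linarith
  choose α β hdom hle using hex
  refine (risk_bayesPDE_pi_le (spikeSlab η l) hr.ne' θ α β hdom).trans
    (ENNReal.ofReal_le_ofReal ((Finset.sum_le_sum fun i _ => hle i).trans ?_))
  have hk : hammingNorm θ ≤ k := by
    have h4 : (hammingNorm θ : ℝ) < k + 1 := hθ.1.trans_lt hs
    exact Nat.lt_succ_iff.1 (by exact_mod_cast h4)
  have hsum : ∑ i, (if θ i ≠ 0 then riskBound r c l else 0) =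
      hammingNorm θ * riskBound r c l := by
    rw [← Finset.sum_filter, Finset.sum_const, nsmul_eq_mul]
    rfl
  -- The `n` terms `2η` total at most `4k` by `hnη`, which is the `+ 4` per spike.
  rw [Finset.sum_add_distrib, hsum, Finset.sum_const, Finset.card_univ, Fintype.card_fin,
    nsmul_eq_mul]
  have : (hammingNorm θ : ℝ) * riskBound r c l ≤ k * riskBound r c l :=
    mul_le_mul_of_nonneg_right (Nat.cast_le.2 hk) hM
  linarith

theorem minimaxRisk_le_maxRisk_spikeSlabPDE {r : ℝ≥0} (hr : 0 < r) {n : ℕ} (h0 : 0 ≤ η)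
    (h1 : η ≤ 1) (hl : 0 < l) (Θ : Set (Fin n → ℝ)) :
    minimaxRisk r Θ ≤ maxRisk r Θ (spikeSlabPDE n r η l) := by
  have := isProbabilityMeasure_spikeSlab h0 h1 hl
  exact iInf₂_le _ (isPDE_bayesPDE_pi (spikeSlab η l) hr.ne')

end Bounds

/-! ### Asymptotics -/

/-- The normalized lower bound for the minimax risk per spike, at log inverse sparsity `Λ`. -/
noncomputable def lowerRate (r : ℝ≥0) (Λ : ℝ) : ℝ :=
  (Λ - Real.log 2) / (1 + r) - (2 * √Λ + 2 * √Λ / √r + 1)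

theorem ofReal_lowerRate_le_minimaxRisk {r : ℝ≥0} (hr : 0 < r) {n : ℕ} (hn : n ≠ 0) {s t η : ℝ}
    (hs : 1 ≤ s) (hη : η = s / n) (hη2 : η ≤ 1 / 2) (hΛ : Real.log 2 ≤ Real.log η⁻¹)
    (ht : 2 * √(Real.log η⁻¹) ≤ t) :
    ENNReal.ofReal (⌊s⌋₊ * lowerRate r (Real.log η⁻¹)) ≤ minimaxRisk r (sparseSet n s t) := by
  have hr' : (0 : ℝ) < r := hr
  have hlog2 : 0 < Real.log 2 := Real.log_pos one_lt_two
  have hn' : (0 : ℝ) < n := Nat.cast_pos.2 (Nat.pos_of_ne_zero hn)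
  have hη0 : 0 < η := hη ▸ by positivity
  set k := ⌊s⌋₊ with hk
  have hk1 : 1 ≤ k := Nat.one_le_floor_iff s |>.2 hs
  have hk1' : (1 : ℝ) ≤ k := by exact_mod_cast hk1
  have hks : (k : ℝ) ≤ s := Nat.floor_le (by linarith)
  have hsk : s < k + 1 := Nat.lt_floor_add_one s
  -- Division in `ℕ`. Rounding both `s` and `n / k` keeps `m` between `η⁻¹ / 2` and `2 η⁻¹`, so `log
  -- m` is within `log 2` of `Λ`.
  set m := n / k with hm
  set Λ := Real.log η⁻¹ with hΛdef
  have hdiv : η⁻¹ ≤ n / k := by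
    rw [hη, inv_div]
    gcongr
  have hdiv' : (n : ℝ) / k ≤ 2 * η⁻¹ := by
    rw [hη, inv_div, div_le_iff₀ (by linarith), mul_div_assoc', div_mul_eq_mul_div,
      le_div_iff₀ (by linarith)]
    nlinarith
  have hm_le : (m : ℝ) ≤ n / k := Nat.cast_div_le
  have hm_ge : (n : ℝ) / k < m + 1 := by
    rw [← Nat.floor_div_eq_div (K := ℝ) n k] at hm
    rw [hm]
    exact Nat.lt_floor_add_one _
  have hinv : 2 ≤ η⁻¹ := by
    rw [le_inv_comm₀ two_pos hη0]
    linarith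
  have hm_ge' : η⁻¹ / 2 ≤ m := by linarith
  have hm0 : (0 : ℝ) < m := by linarith
  have hlogm : Λ - Real.log 2 ≤ Real.log m := by
    rw [hΛdef, ← Real.log_div (by positivity) two_ne_zero]
    exact Real.log_le_log (by positivity) hm_ge'
  have hlogm' : Real.log m ≤ Λ + Real.log 2 := by
    rw [hΛdef, add_comm, ← Real.log_mul two_ne_zero (by positivity)]
    exact Real.log_le_log hm0 (hm_le.trans hdiv')
  have hlogm0 : 0 ≤ Real.log m := by linarith
  -- The solution of the calibration equation; it is at most `2 √Λ` because `log m ≤ Λ + log 2 ≤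
  -- 2Λ`.
  set a := √(2 * (r / (1 + r)) * Real.log m) with ha
  have ha0 : 0 ≤ a := Real.sqrt_nonneg _
  have hasq : a ^ 2 = 2 * (r / (1 + r)) * Real.log m := Real.sq_sqrt (by positivity)
  have hv : r / (1 + r) ≤ (1 : ℝ) := (div_le_one (by positivity)).2 (by linarith)
  have ha_le : a ≤ 2 * √Λ := by
    rw [ha, Real.sqrt_le_left (by positivity), mul_pow, Real.sq_sqrt (by linarith)]
    nlinarith
  have hcal : a ^ 2 / 2 + a ^ 2 / (2 * r) = Real.log m := by
    rw [hasq]; field_simp; ring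
  refine le_trans (ENNReal.ofReal_le_ofReal ?_) (ofReal_le_minimaxRisk ha0 hr
    (Nat.cast_ne_zero.1 hm0.ne') hcal (Nat.mul_div_le n k) hks (ha_le.trans ht))
  refine mul_le_mul_of_nonneg_left ?_ (Nat.cast_nonneg _)
  have e1 : Real.log m - a ^ 2 / 2 = Real.log m / (1 + r) := by
    rw [hasq]; field_simp; ring
  rw [e1, lowerRate]
  have h1 : (Λ - Real.log 2) / (1 + r) ≤ Real.log m / (1 + r) := by gcongr
  have h2 : a / √r ≤ 2 * √Λ / √r := by gcongr
  linarith

theorem tendsto_inv_sqrt_atTop : Tendsto (fun x : ℝ => (√x)⁻¹) atTop (𝓝 0) :=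
  tendsto_inv_atTop_zero.comp Real.tendsto_sqrt_atTop

theorem tendsto_lowerRate_div (r : ℝ≥0) :
    Tendsto (fun Λ => lowerRate r Λ / Λ) atTop (𝓝 (1 / (1 + r))) := by
  have h : Tendsto (fun Λ : ℝ => 1 / (1 + r) - (2 + 2 / √r) * (√Λ)⁻¹ -
      (Real.log 2 / (1 + r) + 1) * Λ⁻¹) atTop
      (𝓝 (1 / (1 + r) - (2 + 2 / √r) * 0 - (Real.log 2 / (1 + r) + 1) * 0)) :=
    (tendsto_const_nhds.sub (tendsto_inv_sqrt_atTop.const_mul _)).sub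
      (tendsto_inv_atTop_zero.const_mul _)
  rw [mul_zero, mul_zero, sub_zero, sub_zero] at h
  refine h.congr' ?_
  filter_upwards [eventually_gt_atTop 0] with Λ hΛ
  have e : (√Λ)⁻¹ = √Λ / Λ := by rw [Real.sqrt_div_self]
  rw [e, lowerRate]
  field_simp
  ring

theorem tendsto_riskBound_div {ι : Type*} {f : Filter ι} (r : ℝ≥0) {Λ t : ι → ℝ}
    (hΛ : Tendsto Λ f atTop) (ht : ∀ᶠ n in f, 0 < t n)
    (hlog : Tendsto (fun n => Real.log (t n) / Λ n) f (𝓝 0)) :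
    Tendsto (fun n => (riskBound r √(2 * Λ n) (t n) + 4) / Λ n) f (𝓝 (1 / (1 + r))) := by
  set K : ℝ := 1 / 2 + 2 * Real.log 2 + Real.log 2 + (1 + 1 / r) / 6 + 4 with hK
  have h : Tendsto (fun n => 1 / (1 + r) + √2 * (√(Λ n))⁻¹ + K * (Λ n)⁻¹ +
      Real.log (t n) / Λ n) f (𝓝 (1 / (1 + r) + √2 * 0 + K * 0 + 0)) :=
    ((tendsto_const_nhds.add ((tendsto_inv_sqrt_atTop.comp hΛ).const_mul _)).add
      ((tendsto_inv_atTop_zero.comp hΛ).const_mul _)).add hlog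
  rw [mul_zero, mul_zero, add_zero, add_zero, add_zero] at h
  refine h.congr' ?_
  filter_upwards [hΛ.eventually_gt_atTop 0, ht] with n hn htn
  have e : (√(Λ n))⁻¹ = √(Λ n) / Λ n := by rw [Real.sqrt_div_self]
  rw [e, riskBound, Real.sq_sqrt (by positivity), Real.log_mul two_ne_zero htn.ne',
    Real.sqrt_mul zero_le_two, hK]
  field_simp
  ring

end SparsePrediction

/-! ### Squeezing the risk ratio. -/

theorem theorem4 (r : ℝ≥0) (hr : 0 < r) (s t η : ℕ → ℝ)
    (hs : ∀ n, 1 ≤ s n)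
    (hη : ∀ n, η n = s n / n)
    (hη0 : Tendsto η atTop (𝓝 0))
    (ht : Tendsto (fun n => t n / √(Real.log (η n)⁻¹)) atTop atTop)
    (hlog : Tendsto (fun n => Real.log (t n) / Real.log (η n)⁻¹) atTop (𝓝 0)) :
    Tendsto
      (fun n => SparsePrediction.maxRisk r (SparsePrediction.sparseSet n (s n) (t n))
            (SparsePrediction.spikeSlabPDE n r (η n) (t n)) /
          SparsePrediction.minimaxRisk r (SparsePrediction.sparseSet n (s n) (t n)))
      atTop (𝓝 1) := by
  open SparsePrediction in
  have hηpos : ∀ᶠ n in atTop, 0 < η n := by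
    filter_upwards [eventually_gt_atTop 0] with n hn
    have : (0 : ℝ) < n := Nat.cast_pos.2 hn
    have := hs n
    rw [hη]
    positivity
  have hηlt : ∀ᶠ n in atTop, η n < 1 / 2 := hη0.eventually_lt_const (by norm_num)
  have hΛ : Tendsto (fun n => Real.log (η n)⁻¹) atTop atTop :=
    Real.tendsto_log_atTop.comp (tendsto_inv_nhdsGT_zero.comp
      (tendsto_nhdsWithin_iff.2 ⟨hη0, hηpos⟩))
  have htΛ : ∀ᶠ n in atTop, 2 * √(Real.log (η n)⁻¹) ≤ t n := by
    filter_upwards [ht.eventually_ge_atTop 2, hΛ.eventually_gt_atTop 0] with n h1 h2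
    rwa [le_div_iff₀ (Real.sqrt_pos.2 h2)] at h1
  have ht2 : ∀ᶠ n in atTop, 2 ≤ t n := by
    filter_upwards [htΛ, hΛ.eventually_ge_atTop 1] with n h1 h2
    have := Real.one_le_sqrt.2 h2
    linarith
  have hU := tendsto_riskBound_div r hΛ (ht2.mono fun n h => by linarith) hlog
  have hL := (tendsto_lowerRate_div r).comp hΛ
  have hrate : (0 : ℝ) < 1 / (1 + r) := by positivity
  -- The number `⌊s n⌋₊` of spikes is common to both bounds and cancels; each remaining rate divided
  -- by `Λ` tends to `1 / (1 + r)`.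
  have hratio : Tendsto (fun n => ENNReal.ofReal
      ((riskBound r √(2 * Real.log (η n)⁻¹) (t n) + 4) / lowerRate r (Real.log (η n)⁻¹)))
      atTop (𝓝 1) := by
    rw [← ENNReal.ofReal_one, ← div_self hrate.ne']
    refine (ENNReal.continuous_ofReal.tendsto _).comp ((hU.div hL hrate.ne').congr' ?_)
    filter_upwards [hΛ.eventually_gt_atTop 0] with n hn
    exact div_div_div_cancel_right₀ hn.ne' _ _
  have hLpos : ∀ᶠ n in atTop, 0 < lowerRate r (Real.log (η n)⁻¹) := by
    filter_upwards [hL.eventually_const_lt hrate, hΛ.eventually_gt_atTop 0] with n h1 h2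
    exact (div_pos_iff_of_pos_right h2).1 h1
  have hbounds : ∀ᶠ n in atTop,
      1 ≤ maxRisk r (sparseSet n (s n) (t n)) (spikeSlabPDE n r (η n) (t n)) /
          minimaxRisk r (sparseSet n (s n) (t n)) ∧
      maxRisk r (sparseSet n (s n) (t n)) (spikeSlabPDE n r (η n) (t n)) /
          minimaxRisk r (sparseSet n (s n) (t n)) ≤ ENNReal.ofReal
      ((riskBound r √(2 * Real.log (η n)⁻¹) (t n) + 4) / lowerRate r (Real.log (η n)⁻¹)) := by
    filter_upwards [hηpos, hηlt, htΛ, ht2, hLpos, hΛ.eventually_ge_atTop (Real.log 2),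
      eventually_gt_atTop 0] with n h1 h2 h3 h4 h5 h6 h7
    have hΛ0 : 0 ≤ Real.log (η n)⁻¹ := (Real.log_pos one_lt_two).le.trans h6
    have hk1 : (1 : ℝ) ≤ ⌊s n⌋₊ := by
      exact_mod_cast (Nat.one_le_floor_iff (s n)).2 (hs n)
    have hsk : s n < ⌊s n⌋₊ + 1 := Nat.lt_floor_add_one _
    have hexp : η n = Real.exp (-(√(2 * Real.log (η n)⁻¹) ^ 2 / 2)) := by
      rw [Real.sq_sqrt (by positivity), mul_div_cancel_left₀ _ two_ne_zero, Real.log_inv, neg_neg,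
        Real.exp_log h1]
    have hnη : n * η n ≤ 2 * ⌊s n⌋₊ := by
      rw [hη, mul_div_cancel₀ _ (Nat.cast_ne_zero.2 h7.ne')]
      linarith
    have hupper := maxRisk_spikeSlabPDE_le hr h1 h2.le h4 (Real.sqrt_nonneg _) hexp hsk hnη
    have hlower := ofReal_lowerRate_le_minimaxRisk hr h7.ne' (hs n) (hη n) h2.le h6 h3
    have hle := minimaxRisk_le_maxRisk_spikeSlabPDE hr h1.le (by linarith : η n ≤ 1)
      (by linarith : 0 < t n) (sparseSet n (s n) (t n))
    -- In `ℝ≥0∞` both `0 / 0` and `∞ / ∞` are 0, so the lower bound 1 on the ratio needs a minimax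
    -- risk that is positive and finite.
    have hR0 : minimaxRisk r (sparseSet n (s n) (t n)) ≠ 0 := by
      refine (lt_of_lt_of_le ?_ hlower).ne'
      exact ENNReal.ofReal_pos.2 (by positivity)
    have hRt : minimaxRisk r (sparseSet n (s n) (t n)) ≠ ∞ :=
      ne_top_of_le_ne_top ENNReal.ofReal_ne_top (hle.trans hupper)
    constructor
    · rwa [ENNReal.le_div_iff_mul_le (Or.inl hR0) (Or.inl hRt), one_mul]
    · refine ENNReal.div_le_of_le_mul (hupper.trans ?_)
      refine le_trans (le_of_eq ?_) (mul_le_mul_right hlower _)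
      rw [mul_comm (ENNReal.ofReal (_ / _)), ← ENNReal.ofReal_mul (by positivity)]
      rw [mul_assoc, mul_div_cancel₀ _ h5.ne']
  exact tendsto_of_tendsto_of_tendsto_of_le_of_le' tendsto_const_nhds hratio
    (hbounds.mono fun n h => h.1) (hbounds.mono fun n h => h.2)
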